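/- For $m\in\mathbb N$ let $P_m$ be the complex vector space of homogeneous polynomials of degree $m$ in $x_1,x_2$, with the inner product $\langle x_1^l x_2^{m-l},x_1^k x_2^{m-k}\rangle=l!\,(m-l)!\,\delta_{lk}$ and the orthonormal basis $f^m_l=x_1^l x_2^{m-l}/\sqrt{l!\,(m-l)!}$, $0\le l\le m$, and let $SU(2)$ act on it by the irreducible unitary representation $(\rho_m(g)f)(x_1,x_2)=f((x_1,x_2)g)$. A quantum channel is a completely positive trace preserving linear map; a quantum channel $\Phi:\mathrm{End}(P_r)\to\mathrm{End}(P_m)$ is $SU(2)$-irreducibly covariant if $\Phi(\rho_r(g)A\rho_r(g)^*)=\rho_m(g)\Phi(A)\rho_m(g)^*$ for all $g\in SU(2)$ and $A\in\mathrm{End}(P_r)$. The minimal output entropy of $\Phi$ is $S_{\min}(\Phi)=\min_{\|w\|=1}S(\Phi(ww^*))$, where $S(\varrho)=-\mathrm{tr}(\varrho\log_2\varrho)$ and $0\log_2 0=0$. For $0\le h\le\min\{m,n\}$ and $r=m+n-2h$, the EPOSIC channel $\Phi_{m,n,h}:\mathrm{End}(P_r)\to\mathrm{End}(P_m)$ is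 $\Phi_{m,n,h}(A)=\sum_{j=0}^n T_jAT_j^*$ with $$T_j=\sum_{i=\max\{0,j-h\}}^{\min\{r,m-h+j\}}\varepsilon_i^j\, f^m_{i-j+h}(f^r_i)^*,\qquad \varepsilon_i^j=\sum_{s=\max\{0,j-i,j+h-n\}}^{\min\{h,j,j+m-i-h\}}\frac{(-1)^s\binom hs\binom{n-h}{j-s}\binom{m-h}{i-j+s}}{\sqrt{\binom ri\binom m{i-j+h}\binom nj\sum_{k=0}^h\binom hk^2\big/\left(\binom m{h-k}\binom nk\right)}}.$$ **Proposition.** Let $m\ge 1$ be an integer. 1. Let $\Phi:\mathrm{End}(P_1)\to\mathrm{End}(P_m)$ be an $SU(2)$-irreducibly covariant channel. Then there is $p\in[0,1]$ such that $\Phi=p\,\Phi_{m,m+1,m}+(1-p)\,\Phi_{m,m-1,m-1}$ and $$S_{\min}(\Phi)=-\sum_{j=0}^m\lambda_j\log_2\lambda_j,\qquad \lambda_j=\frac{2(m-j+1)}{(m+1)(m+2)}\,p+\frac{2j}{m(m+1)}\,(1-p).$$ The minimum defining $S_{\min}(\Phi)$ is attained, and for all unit vectors $w,w'\in P_1$ there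 is a unitary $U$ on $P_m$ with $\Phi(w'w'^*)=U\,\Phi(ww^*)\,U^*$. 2. $\Phi_{m,m+1,m}$ and $\Phi_{m,m-1,m-1}$ are $SU(2)$-irreducibly covariant channels, and $$S_{\min}(\Phi_{m,m+1,m})=-\sum_{j=1}^{m+1}\frac{2j}{(m+1)(m+2)}\log_2\frac{2j}{(m+1)(m+2)},\qquad S_{\min}(\Phi_{m,m-1,m-1})=-\sum_{j=1}^{m}\frac{2j}{m(m+1)}\log_2\frac{2j}{m(m+1)}.$$ -/

import Mathlib

open scoped ComplexConjugate

noncomputable section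

/-! ### Quantum channels, pure states, entropy -/

section General

/-- A quantum channel `End(H) → End(K)`: a completely positive, trace preserving linear map. -/
def IsQuantumChannel {H K : Type*}
    [NormedAddCommGroup H] [InnerProductSpace ℂ H] [CompleteSpace H]
    [NormedAddCommGroup K] [InnerProductSpace ℂ K] [CompleteSpace K]
    (Φ : (H →L[ℂ] H) →ₗ[ℂ] (K →L[ℂ] K)) : Prop :=
  (∃ φ : CompletelyPositiveMap (H →L[ℂ] H) (K →L[ℂ] K), φ.toLinearMap = Φ) ∧
    ∀ A : H →L[ℂ] H,
      LinearMap.trace ℂ K ((Φ A : K →L[ℂ] K) : K →ₗ[ℂ] K) =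
        LinearMap.trace ℂ H (A : H →ₗ[ℂ] H)

/-- The operator `w w*`, i.e. `z ↦ ⟨w, z⟩ w`. For a unit vector `w` it is a pure state. -/
def ketBra {H : Type*} [NormedAddCommGroup H] [InnerProductSpace ℂ H] (w : H) : H →L[ℂ] H :=
  InnerProductSpace.rankOne ℂ w w

/-- The pure states on `H`: the operators `w w*` with `w` a unit vector. -/
def pureStates (H : Type*) [NormedAddCommGroup H] [InnerProductSpace ℂ H] :
    Set (H →L[ℂ] H) :=
  {ϱ | ∃ w : H, ‖w‖ = 1 ∧ ϱ = ketBra w}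

/-- The von Neumann entropy `S(ϱ) = - tr (ϱ log₂ ϱ)`, where `ϱ log₂ ϱ` is obtained by applying
the (continuous) function `x ↦ x log₂ x`, with value `0` at `0`, to the state `ϱ` by functional
calculus. -/
def vonNeumannEntropy {H : Type*} [NormedAddCommGroup H] [InnerProductSpace ℂ H]
    [CompleteSpace H] (ϱ : H →L[ℂ] H) : ℝ :=
  -(LinearMap.trace ℂ H
      ((cfc (fun x : ℝ => x * Real.logb 2 x) ϱ : H →L[ℂ] H) : H →ₗ[ℂ] H)).re

/-- The set of the entropies of all outputs of `Φ` on pure input states. -/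
def pureOutputEntropies {H K : Type*}
    [NormedAddCommGroup H] [InnerProductSpace ℂ H]
    [NormedAddCommGroup K] [InnerProductSpace ℂ K] [CompleteSpace K]
    (Φ : (H →L[ℂ] H) →ₗ[ℂ] (K →L[ℂ] K)) : Set ℝ :=
  (fun ϱ => vonNeumannEntropy (Φ ϱ)) '' pureStates H

/-- The minimal output entropy `S_min(Φ)` (as an infimum; that it is attained is a separate
assertion, `IsLeast (pureOutputEntropies Φ) (minOutputEntropy Φ)`). -/
def minOutputEntropy {H K : Type*}
    [NormedAddCommGroup H] [InnerProductSpace ℂ H]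
    [NormedAddCommGroup K] [InnerProductSpace ℂ K] [CompleteSpace K]
    (Φ : (H →L[ℂ] H) →ₗ[ℂ] (K →L[ℂ] K)) : ℝ :=
  sInf (pureOutputEntropies Φ)

end General

/-! ### The spaces `P_m` of homogeneous polynomials in two variables -/

/-- `P_m`: the homogeneous polynomials of degree `m` in `x₁ = X 0` and `x₂ = X 1`. -/
def HomPoly (m : ℕ) : Type :=
  ↥(MvPolynomial.homogeneousSubmodule (Fin 2) ℂ m)

namespace HomPoly

instance (m : ℕ) : AddCommGroup (HomPoly m) :=
  inferInstanceAs (AddCommGroup ↥(MvPolynomial.homogeneousSubmodule (Fin 2) ℂ m))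

instance (m : ℕ) : Module ℂ (HomPoly m) :=
  inferInstanceAs (Module ℂ ↥(MvPolynomial.homogeneousSubmodule (Fin 2) ℂ m))

/-- The exponent of the monomial `x₁ ^ l * x₂ ^ (m - l)`. -/
def expo (m l : ℕ) : Fin 2 →₀ ℕ := Finsupp.single 0 l + Finsupp.single 1 (m - l)

/-- The inclusion of `P_m` in the ring of polynomials. -/
def toPoly (m : ℕ) : HomPoly m →ₗ[ℂ] MvPolynomial (Fin 2) ℂ :=
  (MvPolynomial.homogeneousSubmodule (Fin 2) ℂ m).subtype

/-- The coefficients of `x₁ ^ l * x₂ ^ (m - l)`, for `l = 0, …, m`. -/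
def coeffs (m : ℕ) : HomPoly m →ₗ[ℂ] (Fin (m + 1) → ℂ) where
  toFun f l := (toPoly m f).coeff (expo m l)
  map_add' f g := by ext l; simp
  map_smul' c f := by ext l; simp

theorem coeffs_injective (m : ℕ) : Function.Injective (coeffs m) := by
  rw [← LinearMap.ker_eq_bot, LinearMap.ker_eq_bot']
  intro f hf
  suffices h0 : toPoly m f = 0 from Subtype.ext h0
  apply MvPolynomial.ext
  intro d
  rw [MvPolynomial.coeff_zero]
  by_contra hne
  have hh : (toPoly m f).IsHomogeneous m := f.2
  have hd : d.degree = m := by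
    rw [Finsupp.degree_eq_weight_one]
    exact hh (d := d) hne
  have hsum : d 0 + d 1 = m := by
    rw [← hd, Finsupp.degree_eq_sum]; simp
  have hexp : expo m (d 0) = d := by
    ext i
    fin_cases i
    · simp [expo]
    · simp [expo]; omega
  have := congrFun hf ⟨d 0, by omega⟩
  apply hne
  simpa [coeffs, hexp] using this

/-- The inner product with `⟨x₁^l x₂^(m-l), x₁^k x₂^(m-k)⟩ = l! (m-l)! δ_{lk}`
(conjugate-linear in the first argument). -/
abbrev innerCore (m : ℕ) : InnerProductSpace.Core ℂ (HomPoly m) where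
  inner f g := ∑ l : Fin (m + 1),
    ((l : ℕ).factorial * (m - l).factorial : ℂ) * (conj (coeffs m f l) * coeffs m g l)
  conj_inner_symm f g := by
    simp only [map_sum, map_mul, Complex.conj_conj, Complex.conj_natCast]
    exact Finset.sum_congr rfl fun l _ => by ring
  re_inner_nonneg f := by
    rw [map_sum]
    refine Finset.sum_nonneg fun l _ => ?_
    rw [← Complex.normSq_eq_conj_mul_self]
    simp only [← Nat.cast_mul]
    rw [← Complex.ofReal_natCast, ← Complex.ofReal_mul]
    exact mul_nonneg (Nat.cast_nonneg _) (Complex.normSq_nonneg _)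
  add_left f g h := by
    simp only [map_add, Pi.add_apply, ← Finset.sum_add_distrib]
    exact Finset.sum_congr rfl fun l _ => by ring
  smul_left f g c := by
    simp only [map_smul, Pi.smul_apply, smul_eq_mul, map_mul, Finset.mul_sum]
    exact Finset.sum_congr rfl fun l _ => by ring
  definite f hf := by
    have h0 : ∑ l : Fin (m + 1),
        ((l : ℕ).factorial * (m - l).factorial : ℝ) * Complex.normSq (coeffs m f l) = 0 := by
      have := congrArg Complex.re hf
      simp only [← Complex.normSq_eq_conj_mul_self] at this
      exact_mod_cast this
    rw [Finset.sum_eq_zero_iff_of_nonneg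
      (fun l _ => mul_nonneg (by positivity) (Complex.normSq_nonneg _))] at h0
    apply coeffs_injective m
    rw [map_zero]
    funext l
    have h1 := h0 l (Finset.mem_univ l)
    have h2 : ((l : ℕ).factorial * (m - l).factorial : ℝ) ≠ 0 := by positivity
    simpa [h2] using h1

instance (m : ℕ) : NormedAddCommGroup (HomPoly m) := (innerCore m).toNormedAddCommGroup

instance (m : ℕ) : InnerProductSpace ℂ (HomPoly m) :=
  InnerProductSpace.ofCore (innerCore m).toCore

instance (m : ℕ) : FiniteDimensional ℂ (HomPoly m) :=
  Module.Finite.of_injective (coeffs m) (coeffs_injective m)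

instance (m : ℕ) : CompleteSpace (HomPoly m) := FiniteDimensional.complete ℂ (HomPoly m)

/-- The standard basis vectors `f_l^m = x₁^l x₂^(m-l) / √(l! (m-l)!)`, `0 ≤ l ≤ m`. -/
def stdVec (m : ℕ) (l : Fin (m + 1)) : HomPoly m :=
  ⟨MvPolynomial.monomial (expo m l)
      (((1 / Real.sqrt ((l : ℕ).factorial * (m - l).factorial : ℝ) : ℝ)) : ℂ), by
    rw [MvPolynomial.mem_homogeneousSubmodule]
    apply MvPolynomial.isHomogeneous_monomial
    have := l.2
    rw [Finsupp.degree_eq_sum]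
    simp only [expo, Fin.sum_univ_two, Finsupp.add_apply, Finsupp.single_apply]
    simp
    omega⟩

end HomPoly

/-! ### The representations `ρ_m` of `SU(2)` -/

/-- The group `SU(2)`. -/
abbrev SU2 : Type := ↥(Matrix.specialUnitaryGroup (Fin 2) ℂ)

/-- The substitution `f(x) ↦ f(x g)`, where `x = (x₁, x₂)` is a row vector, i.e.
`x_j ↦ ∑ i, x_i g_{ij}`. -/
def linSubst (g : Matrix (Fin 2) (Fin 2) ℂ) :
    MvPolynomial (Fin 2) ℂ →ₐ[ℂ] MvPolynomial (Fin 2) ℂ :=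
  MvPolynomial.aeval fun j => ∑ i, g i j • MvPolynomial.X i

theorem linSubst_isHomogeneous (g : Matrix (Fin 2) (Fin 2) ℂ) {m : ℕ}
    {f : MvPolynomial (Fin 2) ℂ} (hf : f.IsHomogeneous m) : (linSubst g f).IsHomogeneous m := by
  have := hf.aeval (fun j => ∑ i, g i j • (MvPolynomial.X i : MvPolynomial (Fin 2) ℂ))
    (n := 1) (fun j => MvPolynomial.IsHomogeneous.sum _ _ _ fun i _ => by
      rw [MvPolynomial.smul_eq_C_mul]
      exact (MvPolynomial.isHomogeneous_X ℂ i).C_mul _)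
  simpa [linSubst] using this

/-- The representation `ρ_m` of `SU(2)` on `P_m`, `(ρ_m(g) f)(x) = f(x g)`. -/
def su2Rep (m : ℕ) : Representation ℂ SU2 (HomPoly m) where
  toFun g :=
    { toFun := fun f => ⟨linSubst g.1 (HomPoly.toPoly m f), linSubst_isHomogeneous g.1 f.2⟩
      map_add' := fun f h => Subtype.ext (by
        simp only [map_add]; rfl)
      map_smul' := fun c f => Subtype.ext (by
        simp only [map_smul]; rfl) }
  map_one' := by
    refine LinearMap.ext fun f => Subtype.ext ?_
    have : linSubst 1 = AlgHom.id ℂ _ := by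
      apply MvPolynomial.algHom_ext
      intro j
      simp [linSubst, Matrix.one_apply]
    change linSubst 1 (HomPoly.toPoly m f) = HomPoly.toPoly m f
    rw [this]; rfl
  map_mul' g h := by
    refine LinearMap.ext fun f => Subtype.ext ?_
    have : linSubst (g.1 * h.1) = (linSubst g.1).comp (linSubst h.1) := by
      apply MvPolynomial.algHom_ext
      intro j
      fin_cases j <;>
        simp [linSubst, Matrix.mul_apply, MvPolynomial.smul_eq_C_mul] <;> ring
    change linSubst (g.1 * h.1) (HomPoly.toPoly m f) =
      linSubst g.1 (linSubst h.1 (HomPoly.toPoly m f))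
    rw [this]; rfl

/-- The operator `ρ_m(g)` as an element of `End(P_m)`. -/
def su2Op (m : ℕ) (g : SU2) : HomPoly m →L[ℂ] HomPoly m :=
  LinearMap.toContinuousLinearMap (su2Rep m g)

/-- `Φ : End(P_r) → End(P_m)` is an `SU(2)`-(irreducibly) covariant channel: a quantum channel with
`Φ(ρ_r(g) A ρ_r(g)*) = ρ_m(g) Φ(A) ρ_m(g)*`. -/
def IsCovariantChannel {r m : ℕ}
    (Φ : (HomPoly r →L[ℂ] HomPoly r) →ₗ[ℂ] (HomPoly m →L[ℂ] HomPoly m)) : Prop :=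
  IsQuantumChannel Φ ∧
    ∀ (g : SU2) (A : HomPoly r →L[ℂ] HomPoly r),
      Φ (su2Op r g ∘L A ∘L ContinuousLinearMap.adjoint (su2Op r g)) =
        su2Op m g ∘L Φ A ∘L ContinuousLinearMap.adjoint (su2Op m g)

/-! ### EPOSIC channels

Throughout, `h ≤ min m n` and `r = m + n - 2 h`; the index `r` is carried along as a separate
argument so that the source space is literally `P_r`. -/

/-- The numbers `β_{i,s,j}^{m,n,h}` (used only when all the differences below are nonnegative). -/
def eposicBeta (m n h r i s j : ℕ) : ℝ :=
  ((-1 : ℝ) ^ s * (h.choose s) * ((n - h).choose (j - s)) * ((m - h).choose (i + s - j))) /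
    Real.sqrt ((r.choose i : ℝ) * (m.choose (i + h - j)) * (n.choose j) *
      ∑ k ∈ Finset.range (h + 1),
        ((h.choose k : ℝ) ^ 2 / ((m.choose (h - k) : ℝ) * (n.choose k))))

/-- The numbers `ε_i^j(m,n,h)`: the sum of `β_{i,s,j}` over
`max {0, j - i, j + h - n} ≤ s ≤ min {h, j, j + m - i - h}`. -/
def eposicEps (m n h r i j : ℕ) : ℝ :=
  ∑ s ∈ Finset.Icc (max (j - i) (j + h - n)) (min (min h j) (j + m - (i + h))),
    eposicBeta m n h r i s j

/-- The Kraus operator `T_j = ∑ ε_i^j f_{i-j+h}^m (f_i^r)*`, the sum running over all `0 ≤ i ≤ r`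
with `0 ≤ i - j + h ≤ m`. -/
def eposicKraus (m n h r j : ℕ) : HomPoly r →L[ℂ] HomPoly m :=
  ∑ i : Fin (r + 1), ∑ l : Fin (m + 1),
    if (l : ℕ) + j = i + h then
      (eposicEps m n h r i j : ℂ) •
        InnerProductSpace.rankOne ℂ (HomPoly.stdVec m l) (HomPoly.stdVec r i)
    else 0

/-- The EPOSIC channel `Φ_{m,n,h} : End(P_r) → End(P_m)`, `A ↦ ∑_{j=0}^n T_j A T_j*`, where
`r = m + n - 2 h`. -/
def eposicChannel (m n h r : ℕ) :
    (HomPoly r →L[ℂ] HomPoly r) →ₗ[ℂ] (HomPoly m →L[ℂ] HomPoly m) where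
  toFun A := ∑ j ∈ Finset.range (n + 1),
    eposicKraus m n h r j ∘L A ∘L ContinuousLinearMap.adjoint (eposicKraus m n h r j)
  map_add' A B := by
    simp [ContinuousLinearMap.add_comp, ContinuousLinearMap.comp_add, Finset.sum_add_distrib]
  map_smul' c A := by
    simp [ContinuousLinearMap.smul_comp, Finset.smul_sum]

/-- The numbers `λ_j = 2 (m - j + 1) p / ((m + 1) (m + 2)) + 2 j (1 - p) / (m (m + 1))`. -/
def outputEigenvalue (m : ℕ) (p : ℝ) (j : ℕ) : ℝ :=
  2 * ((m : ℝ) - j + 1) / (((m : ℝ) + 1) * (m + 2)) * p +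
    2 * (j : ℝ) / ((m : ℝ) * (m + 1)) * (1 - p)

end

/-! Under conjugation by $SU(2)$, $\mathrm{End}(P_1)\cong P_0\oplus P_2$, and for $m\ge1$ each of
these summands occurs exactly once in $\mathrm{End}(P_m)$. The equivariant maps
$\mathrm{End}(P_1)\to\mathrm{End}(P_m)$ therefore form a plane. It is spanned by
$A\mapsto\mathrm{tr}(A)\,1$ (`traceOp`) and by the derived action $A\mapsto d\rho_m(A)$ of
$\mathfrak{gl}_2$ through derivations (`lieOp`). Instead of decomposing representations,
`IsEquivariant.exists_eq` differentiates the covariance along curves in $SU(2)$, extends the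
resulting bracket identities to $\mathfrak{sl}_2$ by complex linearity, and runs a weight argument.

For $\Phi=\alpha\,$`lieOp`$\,+\beta\,$`traceOp`, the Choi operator
$\sum_{a,b}E_{ab}\otimes\Phi(E_{ab})$ has the eigenvalues $\beta$, of multiplicity $m+2$, and
$\alpha(m+1)+\beta$, of multiplicity $m$. Complete positivity makes both nonnegative, and trace
preservation gives $(m+2)\beta+m(\alpha(m+1)+\beta)=2$. So the covariant channels lie on a segment,
with $p=(m+2)\beta/2$. Its end points are the two EPOSIC channels: evaluating the coefficients
$\varepsilon_i^j$ gives $\frac{2}{m(m+1)}\,$`lieOp` (`eposicChannel_lower'`) and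
$\frac{2}{(m+1)(m+2)}((m+1)\,$`traceOp`$\,-\,$`lieOp`$)$ (`eposicChannel_upper`). This is
`IsCovariantChannel.exists_eq_mix`.

The entropy needs no minimisation. $SU(2)$ is transitive on the unit vectors of $P_1$, so by
covariance all pure outputs are unitarily conjugate and have equal entropy
(`pureOutputEntropies_eq_singleton`). The output of $f^1_0(f^1_0)^*$ is diagonal in the standard
basis, with eigenvalues $\lambda_{m-l}$. -/

noncomputable section

open MvPolynomial

/-! ### The orthonormal monomial basis of $P_m$ -/

namespace HomPoly

theorem isTopologicalAddGroup (m : ℕ) : IsTopologicalAddGroup (HomPoly m) := inferInstance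

theorem continuousConstSMul (m : ℕ) : ContinuousConstSMul ℂ (HomPoly m) := inferInstance

attribute [local instance] isTopologicalAddGroup continuousConstSMul

theorem toPoly_injective (m : ℕ) : Function.Injective (toPoly m) := Subtype.val_injective

theorem expo_inj {m l k : ℕ} : expo m l = expo m k ↔ l = k := by
  constructor
  · intro h
    simpa [expo] using DFunLike.congr_fun h 0
  · rintro rfl; rfl

theorem toPoly_stdVec (m : ℕ) (l : Fin (m + 1)) :
    toPoly m (stdVec m l) = monomial (expo m l)
      (((1 / Real.sqrt ((l : ℕ).factorial * (m - l).factorial : ℝ) : ℝ)) : ℂ) := rfl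

theorem coeffs_stdVec (m : ℕ) (l k : Fin (m + 1)) :
    coeffs m (stdVec m l) k =
      if l = k then (((1 / Real.sqrt ((l : ℕ).factorial * (m - l).factorial : ℝ) : ℝ)) : ℂ)
      else 0 := by
  change coeff (expo m k) (toPoly m (stdVec m l)) = _
  rw [toPoly_stdVec, coeff_monomial]
  simp only [expo_inj, Fin.val_inj]

theorem inner_eq_sum (m : ℕ) (f g : HomPoly m) :
    inner ℂ f g = ∑ l : Fin (m + 1),
      ((l : ℕ).factorial * (m - l).factorial : ℂ) * (conj (coeffs m f l) * coeffs m g l) := rfl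

theorem sqrt_factorial_pos (m l : ℕ) :
    0 < Real.sqrt (l.factorial * (m - l).factorial : ℝ) := by
  apply Real.sqrt_pos.2
  positivity

theorem inner_stdVec (m : ℕ) (l : Fin (m + 1)) (f : HomPoly m) :
    inner ℂ (stdVec m l) f =
      (Real.sqrt ((l : ℕ).factorial * (m - l).factorial : ℝ) : ℂ) * coeffs m f l := by
  rw [inner_eq_sum, Finset.sum_eq_single l]
  · rw [coeffs_stdVec, if_pos rfl, Complex.conj_ofReal, ← mul_assoc]
    congr 1
    have h := sqrt_factorial_pos m l
    have h2 : (((l : ℕ).factorial * (m - l).factorial : ℝ) : ℂ) =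
        (Real.sqrt ((l : ℕ).factorial * (m - l).factorial : ℝ) : ℂ) *
        (Real.sqrt ((l : ℕ).factorial * (m - l).factorial : ℝ) : ℂ) := by
      rw [← Complex.ofReal_mul, Real.mul_self_sqrt (by positivity)]
    push_cast at h2
    have h3 : (Real.sqrt ((l : ℕ).factorial * (m - l).factorial : ℝ) : ℂ) ≠ 0 := by
      exact_mod_cast h.ne'
    rw [h2]
    push_cast
    field_simp
  · intro b _ hb
    rw [coeffs_stdVec, if_neg (Ne.symm hb)]
    simp
  · simp

theorem orthonormal_stdVec (m : ℕ) : Orthonormal ℂ (stdVec m) := by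
  rw [orthonormal_iff_ite]
  intro i j
  rw [inner_stdVec, coeffs_stdVec]
  by_cases h : i = j
  · subst h
    have := (sqrt_factorial_pos m i).ne'
    rw [if_pos rfl, if_pos rfl, ← Complex.ofReal_mul]
    rw [mul_one_div_cancel this]
    simp
  · rw [if_neg (Ne.symm h), if_neg h, mul_zero]

theorem sum_inner_smul_stdVec (m : ℕ) (f : HomPoly m) :
    ∑ l, inner ℂ (stdVec m l) f • stdVec m l = f := by
  apply coeffs_injective m
  funext k
  rw [map_sum, Finset.sum_apply, Finset.sum_eq_single k]
  · rw [map_smul, Pi.smul_apply, coeffs_stdVec, if_pos rfl, inner_stdVec, smul_eq_mul]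
    have h3 : (Real.sqrt ((k : ℕ).factorial * (m - k).factorial : ℝ) : ℂ) ≠ 0 := by
      exact_mod_cast (sqrt_factorial_pos m k).ne'
    push_cast
    field_simp
  · intro b _ hb
    rw [map_smul, Pi.smul_apply, coeffs_stdVec, if_neg hb, smul_zero]
  · simp

/-- The vectors `stdVec m l` as an orthonormal basis of `P_m`. -/
def stdBasis (m : ℕ) : OrthonormalBasis (Fin (m + 1)) ℂ (HomPoly m) :=
  OrthonormalBasis.mk (orthonormal_stdVec m) (by
    intro f _
    rw [← sum_inner_smul_stdVec m f]
    exact Submodule.sum_mem _ fun l _ => Submodule.smul_mem _ _ (Submodule.subset_span ⟨l, rfl⟩))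

@[simp] theorem stdBasis_apply (m : ℕ) (l : Fin (m + 1)) : stdBasis m l = stdVec m l := by
  simp [stdBasis]

theorem clm_ext {m : ℕ} {E : Type*} [NormedAddCommGroup E] [NormedSpace ℂ E]
    {S T : HomPoly m →L[ℂ] E} (h : ∀ l, S (stdVec m l) = T (stdVec m l)) : S = T := by
  apply ContinuousLinearMap.coe_injective
  apply (stdBasis m).toBasis.ext
  intro l
  simpa using h l

theorem ext_inner_stdVec {m : ℕ} {f g : HomPoly m}
    (h : ∀ l, inner ℂ (stdVec m l) f = inner ℂ (stdVec m l) g) : f = g := by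
  rw [← sum_inner_smul_stdVec m f, ← sum_inner_smul_stdVec m g]
  simp only [h]

theorem trace_eq_sum_inner {m : ℕ} (T : HomPoly m →L[ℂ] HomPoly m) :
    LinearMap.trace ℂ (HomPoly m) (T : HomPoly m →ₗ[ℂ] HomPoly m) =
      ∑ l, inner ℂ (stdVec m l) (T (stdVec m l)) := by
  rw [LinearMap.trace_eq_sum_inner _ (stdBasis m)]
  simp

theorem toPoly_eq_sum (m : ℕ) (f : HomPoly m) :
    toPoly m f = ∑ l : Fin (m + 1), monomial (expo m l) (coeffs m f l) := by
  conv_lhs => rw [← sum_inner_smul_stdVec m f]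
  rw [map_sum]
  refine Finset.sum_congr rfl fun l _ => ?_
  rw [map_smul, toPoly_stdVec, inner_stdVec, smul_monomial]
  congr 1
  have h3 : (Real.sqrt ((l : ℕ).factorial * (m - l).factorial : ℝ) : ℂ) ≠ 0 := by
    exact_mod_cast (sqrt_factorial_pos m l).ne'
  push_cast
  rw [smul_eq_mul]
  field_simp

end HomPoly

/-! ### The Fischer pairing and the unitarity of `ρ_m` -/

/-- The bilinear pairing of polynomials for which the monomials are orthogonal and the square of
`x₁ ^ a * x₂ ^ b` is `a! b!`. -/
def fischer : MvPolynomial (Fin 2) ℂ →ₗ[ℂ] MvPolynomial (Fin 2) ℂ →ₗ[ℂ] ℂ :=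
  (basisMonomials (Fin 2) ℂ).constr ℂ fun d =>
    ((d 0).factorial * (d 1).factorial : ℂ) • lcoeff ℂ d

theorem fischer_monomial (d : Fin 2 →₀ ℕ) (a : ℂ) (h : MvPolynomial (Fin 2) ℂ) :
    fischer (monomial d a) h = ((d 0).factorial * (d 1).factorial : ℂ) * (a * coeff d h) := by
  have h1 : monomial d a = a • (basisMonomials (Fin 2) ℂ d) := by
    rw [coe_basisMonomials, smul_monomial, smul_eq_mul, mul_one]
  rw [h1, map_smul, fischer, Module.Basis.constr_basis]
  simp only [LinearMap.smul_apply, lcoeff_apply, smul_eq_mul]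
  ring

/-- The factorial weights are chosen exactly so that multiplication by a variable is adjoint to
differentiation in it. -/
theorem fischer_mul_X (f h : MvPolynomial (Fin 2) ℂ) (j : Fin 2) :
    fischer (f * X j) h = fischer f (pderiv j h) := by
  induction f using MvPolynomial.induction_on' with
  | monomial d a =>
    rw [X, monomial_mul, mul_one, fischer_monomial, fischer_monomial, coeff_pderiv]
    fin_cases j <;> simp [Nat.factorial_succ] <;> ring
  | add p q hp hq => rw [add_mul, map_add, map_add, LinearMap.add_apply, LinearMap.add_apply, hp, hq]

theorem linSubst_X (g : Matrix (Fin 2) (Fin 2) ℂ) (j : Fin 2) :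
    linSubst g (X j) = ∑ i, g i j • X i := by
  simp [linSubst]

/-- The chain rule for a linear substitution. -/
theorem pderiv_linSubst (g : Matrix (Fin 2) (Fin 2) ℂ) (f : MvPolynomial (Fin 2) ℂ) (j : Fin 2) :
    pderiv j (linSubst g f) = ∑ i, g j i • linSubst g (pderiv i f) := by
  induction f using MvPolynomial.induction_on with
  | C a => simp [linSubst]
  | add p q hp hq => simp only [map_add, hp, hq, smul_add, Finset.sum_add_distrib]
  | mul_X p k hp =>
    rw [map_mul, Derivation.leibniz, hp, linSubst_X]
    simp only [Derivation.leibniz, map_add, Fin.sum_univ_two, pderiv_X, smul_eq_mul,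
      map_mul, linSubst_X]
    fin_cases j <;> fin_cases k <;> simp [smul_eq_C_mul] <;> ring

theorem coeff_zero_linSubst (g : Matrix (Fin 2) (Fin 2) ℂ) (f : MvPolynomial (Fin 2) ℂ) :
    coeff 0 (linSubst g f) = coeff 0 f := by
  induction f using MvPolynomial.induction_on with
  | C a => simp [linSubst]
  | add p q hp hq => simp only [map_add, coeff_add, hp, hq]
  | mul_X p k hp =>
    simp only [← constantCoeff_eq, map_mul, linSubst_X, map_sum, smul_eq_C_mul]
    simp

/-- Induction on the degree of `f`: a factor $x_k$ on the left becomes a derivative on the right,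
and the chain rule carries that derivative past the substitution. Together with the conjugation that
turns the bilinear pairing into the inner product, this gives the unitarity of $\rho_m$. -/
theorem fischer_linSubst (g : Matrix (Fin 2) (Fin 2) ℂ) (f h : MvPolynomial (Fin 2) ℂ) :
    fischer (linSubst g f) h = fischer f (linSubst g.transpose h) := by
  induction f using MvPolynomial.induction_on generalizing h with
  | C a =>
    have : linSubst g (C a) = C a := by simp [linSubst]
    rw [this, C_apply, fischer_monomial, fischer_monomial, coeff_zero_linSubst]
  | add p q hp hq => simp only [map_add, LinearMap.add_apply, hp, hq]
  | mul_X p k hp =>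
    rw [map_mul, linSubst_X, fischer_mul_X, pderiv_linSubst]
    simp only [Finset.mul_sum, mul_smul_comm, map_sum, LinearMap.sum_apply, map_smul,
      LinearMap.smul_apply, fischer_mul_X, hp, Matrix.transpose_apply]

theorem map_conj_linSubst (g : Matrix (Fin 2) (Fin 2) ℂ) (f : MvPolynomial (Fin 2) ℂ) :
    map (starRingEnd ℂ) (linSubst g f) =
      linSubst (g.map (starRingEnd ℂ)) (map (starRingEnd ℂ) f) := by
  induction f using MvPolynomial.induction_on with
  | C a => simp [linSubst]
  | add p q hp hq => simp only [map_add, hp, hq]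
  | mul_X p k hp =>
    simp only [map_mul, hp, map_X, linSubst_X, map_sum, smul_eq_C_mul, map_C, Matrix.map_apply]

theorem HomPoly.inner_eq_fischer (m : ℕ) (f g : HomPoly m) :
    inner ℂ f g = fischer (map (starRingEnd ℂ) (toPoly m f)) (toPoly m g) := by
  rw [inner_eq_sum, toPoly_eq_sum m f, map_sum, map_sum, LinearMap.sum_apply]
  refine Finset.sum_congr rfl fun l _ => ?_
  rw [map_monomial, fischer_monomial]
  simp [expo, coeffs]

theorem toPoly_su2Op (m : ℕ) (g : SU2) (f : HomPoly m) :
    HomPoly.toPoly m (su2Op m g f) = linSubst g.1 (HomPoly.toPoly m f) := rfl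

theorem SU2.conjTranspose_inv (g : SU2) :
    (((g⁻¹ : SU2) : Matrix (Fin 2) (Fin 2) ℂ).map (starRingEnd ℂ)).transpose = g := by
  ext i j
  have : ((g⁻¹ : SU2) : Matrix (Fin 2) (Fin 2) ℂ) = star (g : Matrix (Fin 2) (Fin 2) ℂ) := rfl
  rw [this]
  simp [Matrix.star_apply]

theorem inner_su2Op_inv (m : ℕ) (g : SU2) (x y : HomPoly m) :
    inner ℂ (su2Op m g⁻¹ x) y = inner ℂ x (su2Op m g y) := by
  rw [HomPoly.inner_eq_fischer, HomPoly.inner_eq_fischer, toPoly_su2Op, toPoly_su2Op,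
    map_conj_linSubst, fischer_linSubst, SU2.conjTranspose_inv]

theorem adjoint_su2Op (m : ℕ) (g : SU2) :
    ContinuousLinearMap.adjoint (su2Op m g) = su2Op m g⁻¹ :=
  ((ContinuousLinearMap.eq_adjoint_iff _ _).2 (inner_su2Op_inv m g)).symm

theorem su2Op_mul (m : ℕ) (g h : SU2) : su2Op m (g * h) = su2Op m g ∘L su2Op m h := by
  ext1 f
  simp [su2Op]

theorem su2Op_one (m : ℕ) : su2Op m 1 = ContinuousLinearMap.id ℂ (HomPoly m) := by
  ext1 f
  simp [su2Op]

theorem su2Op_mem_unitary (m : ℕ) (g : SU2) :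
    su2Op m g ∈ unitary (HomPoly m →L[ℂ] HomPoly m) := by
  rw [Unitary.mem_iff, ContinuousLinearMap.star_eq_adjoint, adjoint_su2Op]
  constructor
  · rw [ContinuousLinearMap.mul_def, ← su2Op_mul, inv_mul_cancel, su2Op_one]; rfl
  · rw [ContinuousLinearMap.mul_def, ← su2Op_mul, mul_inv_cancel, su2Op_one]; rfl

end

noncomputable section

open MvPolynomial

attribute [local instance] HomPoly.isTopologicalAddGroup HomPoly.continuousConstSMul

/-! ### The action of `End(P_1)` on `P_m` by derivations -/

namespace HomPoly

theorem toPoly_stdVec_one_one : toPoly 1 (stdVec 1 1) = X 0 := by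
  rw [toPoly_stdVec, X]
  simp [expo]

theorem toPoly_stdVec_one_zero : toPoly 1 (stdVec 1 0) = X 1 := by
  rw [toPoly_stdVec, X]
  simp [expo]

/-- The variable `X j` is the basis vector `stdVec 1 (Fin.rev j)` of `P_1`. -/
theorem toPoly_stdVec_rev (j : Fin 2) : toPoly 1 (stdVec 1 (Fin.rev j)) = X j := by
  fin_cases j
  · exact toPoly_stdVec_one_one
  · exact toPoly_stdVec_one_zero

end HomPoly

open HomPoly

/-- The derivation of the polynomial ring that extends an endomorphism of `P_1`. -/
def linDer (A : HomPoly 1 →L[ℂ] HomPoly 1) :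
    Derivation ℂ (MvPolynomial (Fin 2) ℂ) (MvPolynomial (Fin 2) ℂ) :=
  mkDerivation ℂ fun j => toPoly 1 (A (stdVec 1 (Fin.rev j)))

theorem linDer_X (A : HomPoly 1 →L[ℂ] HomPoly 1) (j : Fin 2) :
    linDer A (X j) = toPoly 1 (A (stdVec 1 (Fin.rev j))) :=
  mkDerivation_X _ _ _

theorem linDer_toPoly (A : HomPoly 1 →L[ℂ] HomPoly 1) (f : HomPoly 1) :
    linDer A (toPoly 1 f) = toPoly 1 (A f) := by
  have key : (linDer A).toLinearMap ∘ₗ toPoly 1 = toPoly 1 ∘ₗ (A : HomPoly 1 →ₗ[ℂ] HomPoly 1) := by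
    apply (stdBasis 1).toBasis.ext
    intro l
    obtain ⟨j, rfl⟩ := Fin.rev_surjective l
    simp only [OrthonormalBasis.coe_toBasis, stdBasis_apply, LinearMap.comp_apply,
      toPoly_stdVec_rev]
    exact linDer_X A j
  exact LinearMap.congr_fun key f

/-- A derivation is determined by its values on the variables; this form shows that the degree is
preserved, since each $\partial_j$ lowers it by one and each value on a variable is linear. -/
theorem linDer_eq_sum (A : HomPoly 1 →L[ℂ] HomPoly 1) (f : MvPolynomial (Fin 2) ℂ) :
    linDer A f = ∑ j, pderiv j f * linDer A (X j) := by
  induction f using MvPolynomial.induction_on with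
  | C a => simp
  | add p q hp hq => simp only [map_add, hp, hq, add_mul, Finset.sum_add_distrib]
  | mul_X p k hp =>
    rw [Derivation.leibniz, hp]
    simp only [Derivation.leibniz, Fin.sum_univ_two, pderiv_X, smul_eq_mul]
    fin_cases k <;> simp <;> ring

theorem linDer_isHomogeneous (A : HomPoly 1 →L[ℂ] HomPoly 1) {m : ℕ}
    {f : MvPolynomial (Fin 2) ℂ} (hf : f.IsHomogeneous m) : (linDer A f).IsHomogeneous m := by
  -- Degree $0$ is separate, since $\partial_j$ cannot lower it; constants are killed.
  rcases m with _ | m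
  · rw [← totalDegree_zero_iff_isHomogeneous] at hf
    rw [totalDegree_eq_zero_iff_eq_C.1 hf, derivation_C]
    exact isHomogeneous_zero _ _ _
  · rw [linDer_eq_sum]
    refine IsHomogeneous.sum _ _ _ fun j _ => ?_
    rw [linDer_X]
    exact hf.pderiv.mul (A (stdVec 1 (Fin.rev j))).2

theorem linDer_add (A B : HomPoly 1 →L[ℂ] HomPoly 1) : linDer (A + B) = linDer A + linDer B := by
  apply derivation_ext
  intro i
  simp [linDer_X]

theorem linDer_smul (c : ℂ) (A : HomPoly 1 →L[ℂ] HomPoly 1) : linDer (c • A) = c • linDer A := by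
  apply derivation_ext
  intro i
  simp [linDer_X]

/-- The derived action of `End(P_1)` on `P_m`. -/
def lieOp (m : ℕ) : (HomPoly 1 →L[ℂ] HomPoly 1) →ₗ[ℂ] (HomPoly m →L[ℂ] HomPoly m) where
  toFun A := LinearMap.toContinuousLinearMap
    { toFun := fun f => ⟨linDer A (toPoly m f), linDer_isHomogeneous A f.2⟩
      map_add' := fun f h => Subtype.ext (by simp only [map_add]; rfl)
      map_smul' := fun c f => Subtype.ext ((linDer A).map_smul c (toPoly m f)) }
  map_add' A B := by
    ext1 f
    apply Subtype.ext
    change linDer (A + B) (toPoly m f) = linDer A (toPoly m f) + linDer B (toPoly m f)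
    rw [linDer_add]; rfl
  map_smul' c A := by
    ext1 f
    apply Subtype.ext
    change linDer (c • A) (toPoly m f) = c • linDer A (toPoly m f)
    rw [linDer_smul]; rfl

theorem toPoly_lieOp (m : ℕ) (A : HomPoly 1 →L[ℂ] HomPoly 1) (f : HomPoly m) :
    toPoly m (lieOp m A f) = linDer A (toPoly m f) := rfl

/-- Both sides are derivations along the ring homomorphism `linSubst g`, so it suffices that they
agree on the variables, and there the claim is the hypothesis `h`. -/
theorem linSubst_linDer (g : SU2) (A B : HomPoly 1 →L[ℂ] HomPoly 1)
    (h : su2Op 1 g ∘L A = B ∘L su2Op 1 g) (f : MvPolynomial (Fin 2) ℂ) :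
    linSubst g.1 (linDer A f) = linDer B (linSubst g.1 f) := by
  induction f using MvPolynomial.induction_on with
  | C a => simp [linSubst]
  | add p q hp hq => simp only [map_add, hp, hq]
  | mul_X p k hp =>
    have hX : linSubst g.1 (linDer A (X k)) = linDer B (linSubst g.1 (X k)) := by
      rw [← toPoly_stdVec_rev, linDer_toPoly, ← toPoly_su2Op, ← toPoly_su2Op, linDer_toPoly]
      exact congrArg (toPoly 1) (DFunLike.congr_fun h _)
    simp only [Derivation.leibniz, map_mul, map_add, smul_eq_mul, hp, hX]

theorem lieOp_covariant (m : ℕ) (g : SU2) (A : HomPoly 1 →L[ℂ] HomPoly 1) :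
    lieOp m (su2Op 1 g ∘L A ∘L ContinuousLinearMap.adjoint (su2Op 1 g)) =
      su2Op m g ∘L lieOp m A ∘L ContinuousLinearMap.adjoint (su2Op m g) := by
  rw [adjoint_su2Op, adjoint_su2Op]
  have h : su2Op 1 g ∘L A = (su2Op 1 g ∘L A ∘L su2Op 1 g⁻¹) ∘L su2Op 1 g := by
    rw [ContinuousLinearMap.comp_assoc, ContinuousLinearMap.comp_assoc, ← su2Op_mul,
      inv_mul_cancel, su2Op_one, ContinuousLinearMap.comp_id]
  have key : su2Op m g ∘L lieOp m A =
      lieOp m (su2Op 1 g ∘L A ∘L su2Op 1 g⁻¹) ∘L su2Op m g := by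
    ext1 f
    apply toPoly_injective
    exact linSubst_linDer g A _ h (toPoly m f)
  rw [← ContinuousLinearMap.comp_assoc (su2Op m g), key, ContinuousLinearMap.comp_assoc, ← su2Op_mul,
    mul_inv_cancel, su2Op_one, ContinuousLinearMap.comp_id]

/-! ### Matrix units of `End(P_1)` and their action on the standard basis -/

/-- The matrix unit `f_a (f_b)*` of `End(P_1)`. -/
def matUnit (a b : Fin 2) : HomPoly 1 →L[ℂ] HomPoly 1 :=
  InnerProductSpace.rankOne ℂ (stdVec 1 a) (stdVec 1 b)

theorem matUnit_apply (a b c : Fin 2) :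
    matUnit a b (stdVec 1 c) = if b = c then stdVec 1 a else 0 := by
  rw [matUnit, InnerProductSpace.rankOne_apply,
    orthonormal_iff_ite.1 (orthonormal_stdVec 1) b c]
  split_ifs <;> simp

theorem eq_sum_matUnit (A : HomPoly 1 →L[ℂ] HomPoly 1) :
    A = ∑ a, ∑ b, inner ℂ (stdVec 1 a) (A (stdVec 1 b)) • matUnit a b := by
  apply clm_ext
  intro c
  conv_lhs => rw [← sum_inner_smul_stdVec 1 (A (stdVec 1 c))]
  fin_cases c <;> simp [matUnit_apply]

/-- Linear maps on `End(P_1)` that agree on the matrix units are equal. -/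
theorem linearMap_ext_matUnit {M : Type*} [AddCommMonoid M] [Module ℂ M]
    {Φ Ψ : (HomPoly 1 →L[ℂ] HomPoly 1) →ₗ[ℂ] M}
    (h : ∀ a b, Φ (matUnit a b) = Ψ (matUnit a b)) : Φ = Ψ := by
  ext1 A
  rw [eq_sum_matUnit A]
  simp only [map_sum, map_smul, h]

theorem trace_matUnit (a b : Fin 2) :
    LinearMap.trace ℂ (HomPoly 1) (matUnit a b : HomPoly 1 →ₗ[ℂ] HomPoly 1) =
      if a = b then 1 else 0 := by
  have h (x : Fin 2) : inner ℂ (stdVec 1 x) (matUnit a b (stdVec 1 x)) =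
      if b = x then (if x = a then (1 : ℂ) else 0) else 0 := by
    rw [matUnit_apply]
    split_ifs with h1 h2
    · rw [orthonormal_iff_ite.1 (orthonormal_stdVec 1), if_pos h2]
    · rw [orthonormal_iff_ite.1 (orthonormal_stdVec 1), if_neg h2]
    · rw [inner_zero_right]
  rw [trace_eq_sum_inner]
  change ∑ x : Fin 2, inner ℂ (stdVec 1 x) (matUnit a b (stdVec 1 x)) = _
  simp only [h]
  simp [eq_comm]

theorem linDer_matUnit (a b : Fin 2) (f : MvPolynomial (Fin 2) ℂ) :
    linDer (matUnit a b) f = pderiv (Fin.rev b) f * X (Fin.rev a) := by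
  rw [linDer_eq_sum, Finset.sum_eq_single (Fin.rev b)]
  · rw [linDer_X, Fin.rev_rev, matUnit_apply, if_pos rfl, ← toPoly_stdVec_rev, Fin.rev_rev]
  · intro j _ hj
    rw [linDer_X, matUnit_apply, if_neg, map_zero, mul_zero]
    rintro rfl
    simp at hj
  · simp

theorem monomial_pderiv_mul_X (a b : Fin 2) (d : Fin 2 →₀ ℕ) (c : ℂ) :
    pderiv b (monomial d c) * X a =
      monomial (d - Finsupp.single b 1 + Finsupp.single a 1) (c * (d b : ℂ)) := by
  rw [pderiv_monomial, X, monomial_mul, mul_one]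

theorem lieOp_zero_zero (m : ℕ) (l : Fin (m + 1)) :
    lieOp m (matUnit 0 0) (stdVec m l) = ((m : ℂ) - l) • stdVec m l := by
  apply toPoly_injective
  have hl : (l : ℕ) ≤ m := by omega
  rw [toPoly_lieOp, linDer_matUnit, map_smul, toPoly_stdVec, monomial_pderiv_mul_X, smul_monomial]
  have h1 : expo m l (Fin.rev 0) = m - l := by simp [expo]
  rw [h1, smul_eq_mul, mul_comm, Nat.cast_sub hl]
  -- For $l=m$ the exponent of $x_2$ is $0$, and truncated subtraction does not return the original
  -- monomial; the coefficient vanishes there instead.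
  rcases hl.eq_or_lt with h | h
  · rw [h, sub_self, zero_mul, map_zero, map_zero]
  · congr 2
    ext i
    fin_cases i <;> simp [expo]
    omega

theorem lieOp_one_one (m : ℕ) (l : Fin (m + 1)) :
    lieOp m (matUnit 1 1) (stdVec m l) = (l : ℂ) • stdVec m l := by
  apply toPoly_injective
  rw [toPoly_lieOp, linDer_matUnit, map_smul, toPoly_stdVec, monomial_pderiv_mul_X, smul_monomial]
  have h1 : expo m l (Fin.rev 1) = l := by simp [expo]
  rw [h1, smul_eq_mul, mul_comm]
  rcases Nat.eq_zero_or_pos (l : ℕ) with h | h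
  · rw [h]; simp
  · congr 2
    ext i
    fin_cases i <;> simp [expo]
    omega

theorem div_sqrt_mul_mul {a b x y : ℝ} (ha : 0 < a) (hb : 0 < b) (hx : 0 < x) (hy : 0 < y) :
    1 / √(a * x * y) * a = √(a * b) * (1 / √(x * (b * y))) := by
  rw [Real.sqrt_mul (by positivity), Real.sqrt_mul ha.le, Real.sqrt_mul ha.le,
    Real.sqrt_mul hx.le, Real.sqrt_mul hb.le]
  have := Real.sqrt_pos.2 ha
  have := Real.sqrt_pos.2 hb
  have := Real.sqrt_pos.2 hx
  have := Real.sqrt_pos.2 hy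
  field_simp
  rw [Real.sq_sqrt ha.le]

/-- The normalisations of $f_{l+1}$ and $f_l$ turn the factor $l+1$ produced by $\partial_1$ into
the symmetric ladder coefficient $\sqrt{(l+1)(m-l)}$. -/
theorem stdVec_coeff_mul_lower {m l : ℕ} (h : l < m) :
    1 / √((l + 1).factorial * (m - (l + 1)).factorial : ℝ) * ((l + 1 : ℕ) : ℝ) =
      √(((l + 1 : ℕ) : ℝ) * ((m - l : ℕ) : ℝ)) *
        (1 / √(l.factorial * (m - l).factorial : ℝ)) := by
  obtain ⟨k, rfl⟩ : ∃ k, m = l + 1 + k := ⟨m - (l + 1), by omega⟩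
  have e1 : l + 1 + k - (l + 1) = k := by omega
  have e2 : l + 1 + k - l = k + 1 := by omega
  rw [e1, e2, Nat.factorial_succ l, Nat.factorial_succ k]
  push_cast
  exact div_sqrt_mul_mul (by positivity) (by positivity) (by positivity) (by positivity)

theorem stdVec_coeff_mul_raise {m l : ℕ} (h : l < m) :
    1 / √(l.factorial * (m - l).factorial : ℝ) * ((m - l : ℕ) : ℝ) =
      √(((l + 1 : ℕ) : ℝ) * ((m - l : ℕ) : ℝ)) *
        (1 / √((l + 1).factorial * (m - (l + 1)).factorial : ℝ)) := by
  obtain ⟨k, rfl⟩ : ∃ k, m = l + 1 + k := ⟨m - (l + 1), by omega⟩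
  have e1 : l + 1 + k - (l + 1) = k := by omega
  have e2 : l + 1 + k - l = k + 1 := by omega
  rw [e1, e2, Nat.factorial_succ l, Nat.factorial_succ k]
  push_cast
  have := div_sqrt_mul_mul (a := (k : ℝ) + 1) (b := (l : ℝ) + 1) (x := k.factorial)
    (y := l.factorial) (by positivity) (by positivity) (by positivity) (by positivity)
  rw [mul_comm ((l : ℝ) + 1) ((k : ℝ) + 1), mul_comm (l.factorial : ℝ),
    mul_comm (((l : ℝ) + 1) * l.factorial)]
  exact this

theorem lieOp_zero_one_succ (m l : ℕ) (h : l < m) :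
    lieOp m (matUnit 0 1) (stdVec m ⟨l + 1, by omega⟩) =
      ((√(((l + 1 : ℕ) : ℝ) * ((m - l : ℕ) : ℝ)) : ℝ) : ℂ) • stdVec m ⟨l, by omega⟩ := by
  apply toPoly_injective
  rw [toPoly_lieOp, linDer_matUnit, map_smul, toPoly_stdVec, toPoly_stdVec, monomial_pderiv_mul_X,
    smul_monomial, smul_eq_mul, ← Complex.ofReal_mul]
  have h1 : expo m (l + 1) (Fin.rev 1) = l + 1 := by simp [expo]
  rw [h1, ← stdVec_coeff_mul_lower h]
  rw [Complex.ofReal_mul, Complex.ofReal_natCast]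
  congr 2
  ext i
  fin_cases i <;> simp [expo]
  omega

theorem lieOp_zero_one_zero (m : ℕ) : lieOp m (matUnit 0 1) (stdVec m 0) = 0 := by
  apply toPoly_injective
  rw [toPoly_lieOp, linDer_matUnit, toPoly_stdVec, monomial_pderiv_mul_X]
  simp [expo]

theorem lieOp_one_zero_of_lt (m l : ℕ) (h : l < m) :
    lieOp m (matUnit 1 0) (stdVec m ⟨l, by omega⟩) =
      ((√(((l + 1 : ℕ) : ℝ) * ((m - l : ℕ) : ℝ)) : ℝ) : ℂ) • stdVec m ⟨l + 1, by omega⟩ := by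
  apply toPoly_injective
  rw [toPoly_lieOp, linDer_matUnit, map_smul, toPoly_stdVec, toPoly_stdVec, monomial_pderiv_mul_X,
    smul_monomial, smul_eq_mul, ← Complex.ofReal_mul]
  have h1 : expo m l (Fin.rev 0) = m - l := by simp [expo]
  rw [h1, ← stdVec_coeff_mul_raise h]
  rw [Complex.ofReal_mul, Complex.ofReal_natCast]
  congr 2
  ext i
  fin_cases i <;> simp [expo]
  omega

theorem lieOp_one_zero_last (m : ℕ) : lieOp m (matUnit 1 0) (stdVec m (Fin.last m)) = 0 := by
  apply toPoly_injective
  rw [toPoly_lieOp, linDer_matUnit, toPoly_stdVec, monomial_pderiv_mul_X]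
  simp [expo]

end

noncomputable section

open MvPolynomial HomPoly

attribute [local instance] HomPoly.isTopologicalAddGroup HomPoly.continuousConstSMul

/-! ### Elements and one-parameter subgroups of `SU(2)` -/

/-- The element of `SU(2)` with first column `(a, b)`. -/
def SU2.ofColumn (a b : ℂ) (h : Complex.normSq a + Complex.normSq b = 1) : SU2 :=
  ⟨!![a, -conj b; b, conj a], by
    have h' : a * conj a + b * conj b = 1 := by
      rw [Complex.mul_conj, Complex.mul_conj, ← Complex.ofReal_add, h, Complex.ofReal_one]
    rw [Matrix.mem_specialUnitaryGroup_iff, Matrix.mem_unitaryGroup_iff]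
    constructor
    · ext i j
      fin_cases i <;> fin_cases j <;>
        simp only [Matrix.mul_apply, Matrix.star_apply, Fin.sum_univ_two, Fin.zero_eta, Fin.mk_one,
          Matrix.of_apply, Matrix.cons_val_zero, Matrix.cons_val_one, Matrix.one_apply_eq,
          RCLike.star_def, map_neg, Complex.conj_conj]
      · linear_combination h'
      · rw [Matrix.one_apply_ne (by decide)]; ring
      · rw [Matrix.one_apply_ne (by decide)]; ring
      · linear_combination h'
    · rw [Matrix.det_fin_two_of]
      linear_combination h'⟩

theorem SU2.coe_ofColumn (a b : ℂ) (h : Complex.normSq a + Complex.normSq b = 1) :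
    (SU2.ofColumn a b h : Matrix (Fin 2) (Fin 2) ℂ) = !![a, -conj b; b, conj a] := rfl

theorem SU2.inv_ofColumn (a b : ℂ) (h : Complex.normSq a + Complex.normSq b = 1) :
    (SU2.ofColumn a b h)⁻¹ = SU2.ofColumn (conj a) (-b) (by simpa using h) := by
  apply Subtype.ext
  change star (!![a, -conj b; b, conj a] : Matrix (Fin 2) (Fin 2) ℂ) = _
  rw [SU2.coe_ofColumn]
  ext i j
  fin_cases i <;> fin_cases j <;> simp [Matrix.star_apply]

/-- The one-parameter subgroup `t ↦ cos t + sin t X` with `X = (i z, -w̄; w, -i z)`. -/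
def SU2.curve (z : ℝ) (w : ℂ) (h : z ^ 2 + Complex.normSq w = 1) (t : ℝ) : SU2 :=
  SU2.ofColumn (Real.cos t + Real.sin t * (z * Complex.I)) (Real.sin t * w) (by
    rw [map_mul, Complex.normSq_ofReal, Complex.normSq_apply]
    simp only [Complex.add_re, Complex.add_im, Complex.ofReal_re, Complex.ofReal_im,
      Complex.re_ofReal_mul, Complex.im_ofReal_mul, Complex.I_re, Complex.I_im]
    linear_combination (Real.sin t) ^ 2 * h + Real.sin_sq_add_cos_sq t)

theorem SU2.curve_inv (z : ℝ) (w : ℂ) (h : z ^ 2 + Complex.normSq w = 1) (t : ℝ) :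
    (SU2.curve z w h t)⁻¹ = SU2.curve z w h (-t) := by
  rw [SU2.curve, SU2.inv_ofColumn, SU2.curve]
  congr 1
  · simp only [map_add, map_mul, Complex.conj_ofReal, Complex.conj_I, Real.cos_neg, Real.sin_neg]
    push_cast
    ring
  · rw [Real.sin_neg]
    push_cast
    ring

theorem SU2.curve_zero (z : ℝ) (w : ℂ) (h : z ^ 2 + Complex.normSq w = 1) :
    SU2.curve z w h 0 = 1 := by
  apply Subtype.ext
  rw [SU2.curve, SU2.coe_ofColumn]
  ext i j
  fin_cases i <;> fin_cases j <;> simp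

/-- The direction of the curve `SU2.curve z w`. -/
def SU2.dir (z : ℝ) (w : ℂ) : Matrix (Fin 2) (Fin 2) ℂ :=
  !![z * Complex.I, -conj w; w, -(z * Complex.I)]

theorem SU2.hasDerivAt_curve (z : ℝ) (w : ℂ) (h : z ^ 2 + Complex.normSq w = 1) (i j : Fin 2) :
    HasDerivAt (fun t => (SU2.curve z w h t : Matrix (Fin 2) (Fin 2) ℂ) i j) (SU2.dir z w i j) 0 := by
  have hs : HasDerivAt (fun t : ℝ => ((Real.sin t : ℝ) : ℂ)) 1 0 := by
    simpa using (Real.hasDerivAt_sin 0).ofReal_comp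
  have hc : HasDerivAt (fun t : ℝ => ((Real.cos t : ℝ) : ℂ)) 0 0 := by
    simpa using (Real.hasDerivAt_cos 0).ofReal_comp
  simp only [SU2.curve, SU2.coe_ofColumn, SU2.dir, map_add, map_mul, Complex.conj_ofReal,
    Complex.conj_I]
  fin_cases i <;> fin_cases j
  · exact (hc.fun_add (hs.mul_const ((z : ℂ) * Complex.I))).congr_deriv (by simp)
  · exact (hs.mul_const (conj w)).fun_neg.congr_deriv (by simp)
  · exact (hs.mul_const w).congr_deriv (by simp)
  · exact (hc.fun_add (hs.mul_const ((z : ℂ) * -Complex.I))).congr_deriv (by simp)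

/-! ### Differentiating the representations -/

/-- The endomorphism of `P_1` with matrix `X` in the basis `x₁, x₂`. -/
def matOp (X : Matrix (Fin 2) (Fin 2) ℂ) : HomPoly 1 →L[ℂ] HomPoly 1 :=
  ∑ i, ∑ j, X i j • matUnit (Fin.rev i) (Fin.rev j)

theorem linDer_matOp_X (M : Matrix (Fin 2) (Fin 2) ℂ) (j : Fin 2) :
    linDer (matOp M) (X j) = ∑ i, M i j • X i := by
  have : matOp M (stdVec 1 (Fin.rev j)) = ∑ i, M i j • stdVec 1 (Fin.rev i) := by
    fin_cases j <;> simp [matOp, matUnit_apply]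
  rw [linDer_X, this, map_sum]
  simp only [map_smul, toPoly_stdVec_rev]

/-- Coefficientwise differentiation, so that only scalar functions occur. By the product rule the
derivative at the identity obeys the Leibniz rule, hence is the derivation with the prescribed
values on the variables. -/
theorem hasDerivAt_coeff_linSubst {G : ℝ → Matrix (Fin 2) (Fin 2) ℂ}
    {M : Matrix (Fin 2) (Fin 2) ℂ} (h0 : G 0 = 1)
    (hG : ∀ i j, HasDerivAt (fun t => G t i j) (M i j) 0) (f : MvPolynomial (Fin 2) ℂ)
    (d : Fin 2 →₀ ℕ) :
    HasDerivAt (fun t => coeff d (linSubst (G t) f)) (coeff d (linDer (matOp M) f)) 0 := by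
  have hone : linSubst 1 = AlgHom.id ℂ _ := by
    apply MvPolynomial.algHom_ext
    intro j
    simp [linSubst, Matrix.one_apply]
  -- Multiplication by a variable only shifts coefficients, so the induction hypothesis at another
  -- exponent applies.
  have hcoeff (p : MvPolynomial (Fin 2) ℂ) (i : Fin 2) (d : Fin 2 →₀ ℕ) :
      coeff d (p * X i) = if i ∈ d.support then coeff (d - Finsupp.single i 1) p else 0 :=
    coeff_mul_X' _ _ _
  induction f using MvPolynomial.induction_on generalizing d with
  | C a => simpa [linSubst] using hasDerivAt_const (0 : ℝ) (coeff d (C a : MvPolynomial (Fin 2) ℂ))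
  | add p q hp hq => simpa only [map_add, coeff_add] using (hp d).fun_add (hq d)
  | mul_X p k hp =>
    have hp' (i : Fin 2) : HasDerivAt (fun t => coeff d (linSubst (G t) p * X i))
        (coeff d (linDer (matOp M) p * X i)) 0 := by
      simp only [hcoeff]
      split_ifs with hi
      · exact hp _
      · exact hasDerivAt_const _ _
    have hsum := HasDerivAt.fun_sum (u := Finset.univ) fun (i : Fin 2) _ => (hG i k).mul (hp' i)
    simp only [map_mul, linSubst_X, Finset.mul_sum, mul_smul_comm, coeff_sum, coeff_smul,
      smul_eq_mul, Derivation.leibniz, linDer_matOp_X, coeff_add]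
    refine hsum.congr_deriv ?_
    rw [Finset.sum_add_distrib]
    simp only [h0, hone, AlgHom.id_apply, Matrix.one_apply]
    congr 1
    simp [mul_comm (X k)]

theorem clm_eq_sum_rankOne {m : ℕ} (T : HomPoly m →L[ℂ] HomPoly m) :
    T = ∑ k, ∑ l, inner ℂ (stdVec m k) (T (stdVec m l)) •
      InnerProductSpace.rankOne ℂ (stdVec m k) (stdVec m l) := by
  apply clm_ext
  intro c
  conv_lhs => rw [← sum_inner_smul_stdVec m (T (stdVec m c))]
  rw [sum_apply]
  refine Finset.sum_congr rfl fun k _ => ?_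
  rw [sum_apply, Finset.sum_eq_single c]
  · rw [smul_apply, InnerProductSpace.rankOne_apply,
      orthonormal_iff_ite.1 (orthonormal_stdVec m), if_pos rfl, one_smul]
  · intro b _ hb
    rw [smul_apply, InnerProductSpace.rankOne_apply,
      orthonormal_iff_ite.1 (orthonormal_stdVec m), if_neg hb, zero_smul, smul_zero]
  · simp

theorem hasDerivAt_su2Op (m : ℕ) {G : ℝ → SU2} {M : Matrix (Fin 2) (Fin 2) ℂ} (h0 : G 0 = 1)
    (hG : ∀ i j, HasDerivAt (fun t => (G t : Matrix (Fin 2) (Fin 2) ℂ) i j) (M i j) 0) :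
    HasDerivAt (fun t => su2Op m (G t)) (lieOp m (matOp M)) 0 := by
  have key (k l : Fin (m + 1)) :
      HasDerivAt (fun t => inner ℂ (stdVec m k) (su2Op m (G t) (stdVec m l)))
        (inner ℂ (stdVec m k) (lieOp m (matOp M) (stdVec m l))) 0 := by
    simp only [inner_stdVec]
    exact (hasDerivAt_coeff_linSubst (G := fun t => (G t : Matrix (Fin 2) (Fin 2) ℂ))
      (by rw [h0]; rfl) hG (toPoly m (stdVec m l)) (expo m k)).const_mul _
  rw [clm_eq_sum_rankOne (lieOp m (matOp M))]
  have := HasDerivAt.fun_sum (u := Finset.univ) fun (k : Fin (m + 1)) _ =>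
    HasDerivAt.fun_sum (u := Finset.univ) fun (l : Fin (m + 1)) _ =>
      (key k l).smul_const (InnerProductSpace.rankOne ℂ (stdVec m k) (stdVec m l))
  refine this.congr_of_eventuallyEq (Filter.Eventually.of_forall fun t => ?_)
  exact clm_eq_sum_rankOne (su2Op m (G t))

theorem lieOp_one (A : HomPoly 1 →L[ℂ] HomPoly 1) : lieOp 1 A = A := by
  ext1 f
  apply toPoly_injective
  rw [toPoly_lieOp, linDer_toPoly]

/-- `Φ : End(P_1) → End(P_m)` intertwines the conjugation actions of `SU(2)`. -/
def IsEquivariant {m : ℕ} (Φ : (HomPoly 1 →L[ℂ] HomPoly 1) →ₗ[ℂ] (HomPoly m →L[ℂ] HomPoly m)) :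
    Prop :=
  ∀ (g : SU2) (A : HomPoly 1 →L[ℂ] HomPoly 1),
    Φ (su2Op 1 g ∘L A ∘L ContinuousLinearMap.adjoint (su2Op 1 g)) =
      su2Op m g ∘L Φ A ∘L ContinuousLinearMap.adjoint (su2Op m g)

/-- The derivative at $t=0$ of the covariance identity along the curve. The adjoint of $\rho(g_t)$
is $\rho(g_{-t})$, whence the minus sign; on $P_1$ the derived action is the identity map
`lieOp_one`. -/
theorem IsEquivariant.bracket_dir {m : ℕ}
    {Φ : (HomPoly 1 →L[ℂ] HomPoly 1) →ₗ[ℂ] (HomPoly m →L[ℂ] HomPoly m)} (hΦ : IsEquivariant Φ)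
    (z : ℝ) (w : ℂ) (h : z ^ 2 + Complex.normSq w = 1) (A : HomPoly 1 →L[ℂ] HomPoly 1) :
    Φ (matOp (SU2.dir z w) * A - A * matOp (SU2.dir z w)) =
      lieOp m (matOp (SU2.dir z w)) * Φ A - Φ A * lieOp m (matOp (SU2.dir z w)) := by
  have hpos (n : ℕ) := hasDerivAt_su2Op n (SU2.curve_zero z w h) (SU2.hasDerivAt_curve z w h)
  have hconj (n : ℕ) (B : HomPoly n →L[ℂ] HomPoly n) :
      HasDerivAt (fun t => su2Op n (SU2.curve z w h t) ∘L B ∘L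
        ContinuousLinearMap.adjoint (su2Op n (SU2.curve z w h t)))
        (lieOp n (matOp (SU2.dir z w)) * B - B * lieOp n (matOp (SU2.dir z w))) 0 := by
    have hneg : HasDerivAt (fun t => su2Op n (SU2.curve z w h (-t)))
        (-lieOp n (matOp (SU2.dir z w))) 0 := by
      have h1 := hpos n
      rw [← neg_zero] at h1
      exact (h1.scomp (0 : ℝ) (hasDerivAt_neg (0 : ℝ))).congr_deriv (by rw [neg_smul, one_smul])
    simp only [adjoint_su2Op, SU2.curve_inv]
    have := (hpos n).mul (hneg.const_mul B)
    refine this.congr_deriv ?_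
    simp only [neg_zero, SU2.curve_zero, su2Op_one]
    change lieOp n (matOp (SU2.dir z w)) * (B * 1) + 1 * (B * -lieOp n (matOp (SU2.dir z w))) = _
    rw [mul_one, one_mul, mul_neg, sub_eq_add_neg]
  have hl := ((LinearMap.toContinuousLinearMap Φ).restrictScalars ℝ).hasFDerivAt.comp_hasDerivAt
    (0 : ℝ) (hconj 1 A)
  rw [lieOp_one] at hl
  have hr := hconj m (Φ A)
  refine hl.unique (hr.congr_of_eventuallyEq (Filter.Eventually.of_forall fun t => ?_))
  exact hΦ _ A

theorem IsEquivariant.bracket_add {m : ℕ}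
    {Φ : (HomPoly 1 →L[ℂ] HomPoly 1) →ₗ[ℂ] (HomPoly m →L[ℂ] HomPoly m)}
    {X Y : HomPoly 1 →L[ℂ] HomPoly 1} {A : HomPoly 1 →L[ℂ] HomPoly 1}
    (hX : Φ (X * A - A * X) = lieOp m X * Φ A - Φ A * lieOp m X)
    (hY : Φ (Y * A - A * Y) = lieOp m Y * Φ A - Φ A * lieOp m Y) (a b : ℂ) :
    Φ ((a • X + b • Y) * A - A * (a • X + b • Y)) =
      lieOp m (a • X + b • Y) * Φ A - Φ A * lieOp m (a • X + b • Y) := by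
  have h1 : (a • X + b • Y) * A - A * (a • X + b • Y) =
      a • (X * A - A * X) + b • (Y * A - A * Y) := by
    rw [add_mul, mul_add, smul_mul_assoc, smul_mul_assoc, mul_smul_comm, mul_smul_comm,
      smul_sub, smul_sub, add_sub_add_comm]
  rw [h1, map_add, map_smul, map_smul, hX, hY]
  rw [map_add, map_smul, map_smul, add_mul, mul_add, smul_mul_assoc, smul_mul_assoc,
    mul_smul_comm, mul_smul_comm, smul_sub, smul_sub, add_sub_add_comm]

theorem matOp_dir (z : ℝ) (w : ℂ) :
    matOp (SU2.dir z w) = (z * Complex.I) • (matUnit 1 1 - matUnit 0 0) +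
      (w • matUnit 0 1 - conj w • matUnit 1 0) := by
  simp only [matOp, Fin.sum_univ_two]
  change ((z * Complex.I) • matUnit 1 1 + -conj w • matUnit 1 0) +
    (w • matUnit 0 1 + -(z * Complex.I) • matUnit 0 0) = _
  rw [neg_smul, neg_smul, smul_sub]
  abel

theorem eq_half_smul_sub_add {M : Type*} [AddCommGroup M] [Module ℂ M] (x y : M) :
    x = (1 / 2 : ℂ) • (x - y) + -(Complex.I / 2) • (Complex.I • x + Complex.I • y) := by
  have : -(Complex.I / 2) * Complex.I = 1 / 2 := by
    linear_combination (-1 / 2 : ℂ) * Complex.I_mul_I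
  rw [smul_add, smul_smul, smul_smul, this]
  module

/-- The bracket identity is known for directions in the real Lie algebra $\mathfrak{su}(2)$. Both
sides are complex linear in the direction, and $E_{01},E_{10}$ are complex combinations of
$E_{01}-E_{10}$ and $i(E_{01}+E_{10})$. -/
theorem IsEquivariant.bracket_off_diag {m : ℕ}
    {Φ : (HomPoly 1 →L[ℂ] HomPoly 1) →ₗ[ℂ] (HomPoly m →L[ℂ] HomPoly m)} (hΦ : IsEquivariant Φ)
    (A : HomPoly 1 →L[ℂ] HomPoly 1) (a b : Fin 2) (hab : a ≠ b) :
    Φ (matUnit a b * A - A * matUnit a b) =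
      lieOp m (matUnit a b) * Φ A - Φ A * lieOp m (matUnit a b) := by
  have h1 := hΦ.bracket_dir 0 1 (by simp) A
  have h2 := hΦ.bracket_dir 0 Complex.I (by simp) A
  have e1 : matOp (SU2.dir 0 1) = matUnit 0 1 - matUnit 1 0 := by
    rw [matOp_dir, Complex.ofReal_zero, zero_mul, zero_smul, zero_add, map_one, one_smul, one_smul]
  have e2 : matOp (SU2.dir 0 Complex.I) = Complex.I • matUnit 0 1 + Complex.I • matUnit 1 0 := by
    rw [matOp_dir, Complex.ofReal_zero, zero_mul, zero_smul, zero_add, Complex.conj_I, neg_smul,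
      sub_neg_eq_add]
  obtain ⟨c, d, hcd⟩ : ∃ c d : ℂ,
      matUnit a b = c • matOp (SU2.dir 0 1) + d • matOp (SU2.dir 0 Complex.I) := by
    rw [e1, e2]
    have : (a = 0 ∧ b = 1) ∨ (a = 1 ∧ b = 0) := by omega
    rcases this with ⟨rfl, rfl⟩ | ⟨rfl, rfl⟩
    · exact ⟨_, _, eq_half_smul_sub_add _ _⟩
    · refine ⟨-(1 / 2), -(Complex.I / 2), ?_⟩
      rw [neg_smul (1 / 2 : ℂ), ← smul_neg, neg_sub, add_comm (Complex.I • matUnit 0 1)]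
      exact eq_half_smul_sub_add _ _
  rw [hcd]
  exact IsEquivariant.bracket_add h1 h2 c d

theorem IsEquivariant.bracket_diag {m : ℕ}
    {Φ : (HomPoly 1 →L[ℂ] HomPoly 1) →ₗ[ℂ] (HomPoly m →L[ℂ] HomPoly m)} (hΦ : IsEquivariant Φ)
    (A : HomPoly 1 →L[ℂ] HomPoly 1) :
    Φ ((matUnit 0 0 - matUnit 1 1) * A - A * (matUnit 0 0 - matUnit 1 1)) =
      lieOp m (matUnit 0 0 - matUnit 1 1) * Φ A - Φ A * lieOp m (matUnit 0 0 - matUnit 1 1) := by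
  have h1 := hΦ.bracket_dir 1 0 (by simp) A
  have e1 : matUnit 0 0 - matUnit 1 1 =
      Complex.I • matOp (SU2.dir 1 0) + (0 : ℂ) • (0 : HomPoly 1 →L[ℂ] HomPoly 1) := by
    rw [matOp_dir, map_zero, zero_smul, zero_smul, sub_zero, add_zero, smul_zero, add_zero,
      smul_smul, Complex.ofReal_one, one_mul, Complex.I_mul_I, neg_smul, one_smul, neg_sub]
  rw [e1]
  exact IsEquivariant.bracket_add h1 (by simp) _ _

end

noncomputable section

open MvPolynomial HomPoly

attribute [local instance] HomPoly.isTopologicalAddGroup HomPoly.continuousConstSMul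

/-! ### Classification of the equivariant maps -/

theorem inner_stdVec_stdVec {m : ℕ} (k l : Fin (m + 1)) :
    inner ℂ (stdVec m k) (stdVec m l) = if k = l then (1 : ℂ) else 0 :=
  orthonormal_iff_ite.1 (orthonormal_stdVec m) k l

theorem matUnit_mul (a b c d : Fin 2) :
    matUnit a b * matUnit c d = if b = c then matUnit a d else 0 := by
  apply clm_ext
  intro x
  rw [mul_apply_eq_comp, matUnit_apply c d x]
  split_ifs with h1 h2 h2
  · rw [matUnit_apply, if_pos h2, matUnit_apply, if_pos h1]
  · rw [matUnit_apply, if_neg h2, zero_apply]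
  · rw [map_zero, matUnit_apply, if_neg h1]
  · rw [map_zero, zero_apply]

theorem lieOp_weight (m : ℕ) (l : Fin (m + 1)) :
    lieOp m (matUnit 0 0 - matUnit 1 1) (stdVec m l) = ((m : ℂ) - 2 * l) • stdVec m l := by
  rw [map_sub, sub_apply, lieOp_zero_zero, lieOp_one_one, ← sub_smul]
  congr 1
  ring

/-- The weight spaces of `P_m` are one-dimensional. -/
theorem eq_smul_of_weight {m : ℕ} (k : Fin (m + 1)) {v : HomPoly m}
    (hv : lieOp m (matUnit 0 0 - matUnit 1 1) v = ((m : ℂ) - 2 * k) • v) :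
    v = inner ℂ (stdVec m k) v • stdVec m k := by
  apply ext_inner_stdVec
  intro l
  rw [inner_smul_right, inner_stdVec_stdVec]
  by_cases h : l = k
  · rw [if_pos h, mul_one, h]
  · rw [if_neg h, mul_zero]
    have h1 : inner ℂ (stdVec m l) (lieOp m (matUnit 0 0 - matUnit 1 1) v) =
        ((m : ℂ) - 2 * l) * inner ℂ (stdVec m l) v := by
      conv_lhs => rw [← sum_inner_smul_stdVec m v]
      rw [map_sum, inner_sum, Finset.sum_eq_single l]
      · rw [map_smul, lieOp_weight, inner_smul_right, inner_smul_right, inner_stdVec_stdVec,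
          if_pos rfl]
        ring
      · intro b _ hb
        rw [map_smul, lieOp_weight, inner_smul_right, inner_smul_right, inner_stdVec_stdVec,
          if_neg (Ne.symm hb)]
        ring
      · simp
    rw [hv, inner_smul_right] at h1
    have h2 : ((k : ℂ) - l) * inner ℂ (stdVec m l) v = 0 := by linear_combination (-1 / 2 : ℂ) * h1
    have h3 : (k : ℂ) - l ≠ 0 := by
      rw [sub_ne_zero]
      intro h4
      exact h (Fin.ext (by exact_mod_cast h4.symm))
    exact (mul_eq_zero.1 h2).resolve_left h3

/-- An operator commuting with the lowering operator is determined by its value at the last basis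
vector. -/
theorem eq_zero_of_commute_lower {m : ℕ} {T : HomPoly m →L[ℂ] HomPoly m}
    (hT : lieOp m (matUnit 0 1) * T - T * lieOp m (matUnit 0 1) = 0)
    (h0 : T (stdVec m (Fin.last m)) = 0) : T = 0 := by
  have key : ∀ k l : ℕ, (h : l + k = m) → T (stdVec m ⟨l, by omega⟩) = 0 := by
    intro k
    induction k with
    | zero => intro l h; subst h; exact h0
    | succ k ih =>
      intro l h
      have h1 := ih (l + 1) (by omega)
      have h2 := congrArg (fun S => S (stdVec m ⟨l + 1, by omega⟩)) (sub_eq_zero.1 hT)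
      simp only [mul_apply_eq_comp] at h2
      rw [h1, map_zero, lieOp_zero_one_succ m l (by omega), map_smul, eq_comm, smul_eq_zero] at h2
      refine h2.resolve_left ?_
      rw [Complex.ofReal_eq_zero, Real.sqrt_eq_zero']
      have : 0 < m - l := by omega
      push Not
      positivity
  apply clm_ext
  intro l
  exact key (m - l) l (by omega)

theorem isEquivariant_lieOp (m : ℕ) : IsEquivariant (lieOp m) := lieOp_covariant m

theorem IsEquivariant.add {m : ℕ}
    {Φ Ψ : (HomPoly 1 →L[ℂ] HomPoly 1) →ₗ[ℂ] (HomPoly m →L[ℂ] HomPoly m)}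
    (hΦ : IsEquivariant Φ) (hΨ : IsEquivariant Ψ) : IsEquivariant (Φ + Ψ) := by
  intro g A
  rw [LinearMap.add_apply, LinearMap.add_apply, hΦ, hΨ, ContinuousLinearMap.add_comp,
    ContinuousLinearMap.comp_add]

theorem IsEquivariant.smul {m : ℕ}
    {Φ : (HomPoly 1 →L[ℂ] HomPoly 1) →ₗ[ℂ] (HomPoly m →L[ℂ] HomPoly m)}
    (hΦ : IsEquivariant Φ) (c : ℂ) : IsEquivariant (c • Φ) := by
  intro g A
  rw [LinearMap.smul_apply, LinearMap.smul_apply, hΦ, ContinuousLinearMap.smul_comp,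
    ContinuousLinearMap.comp_smul]

/-- The map `A ↦ tr A • 1`. -/
def traceOp (m : ℕ) : (HomPoly 1 →L[ℂ] HomPoly 1) →ₗ[ℂ] (HomPoly m →L[ℂ] HomPoly m) where
  toFun A := LinearMap.trace ℂ (HomPoly 1) (A : HomPoly 1 →ₗ[ℂ] HomPoly 1) •
    (1 : HomPoly m →L[ℂ] HomPoly m)
  map_add' A B := by rw [ContinuousLinearMap.toLinearMap_add, map_add, add_smul]
  map_smul' c A := by
    rw [ContinuousLinearMap.toLinearMap_smul, map_smul, smul_assoc, RingHom.id_apply]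

theorem traceOp_matUnit (m : ℕ) (a b : Fin 2) :
    traceOp m (matUnit a b) = if a = b then 1 else 0 := by
  change LinearMap.trace ℂ (HomPoly 1) (matUnit a b : HomPoly 1 →ₗ[ℂ] HomPoly 1) •
    (1 : HomPoly m →L[ℂ] HomPoly m) = _
  rw [trace_matUnit]
  split_ifs
  · rw [one_smul]
  · rw [zero_smul]

/-- Schur's lemma by hand: subtracting the right multiple of `lieOp` kills $\Phi(E_{01})$; then the
brackets kill the whole traceless part, and what remains is a scalar on the diagonal. -/
theorem IsEquivariant.exists_eq {m : ℕ} (hm : 1 ≤ m)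
    {Φ : (HomPoly 1 →L[ℂ] HomPoly 1) →ₗ[ℂ] (HomPoly m →L[ℂ] HomPoly m)}
    (hΦ : IsEquivariant Φ) : ∃ α β : ℂ, Φ = α • lieOp m + β • traceOp m := by
  -- $[E_{00}-E_{11},E_{01}]=2E_{01}$, so $\Phi(E_{01})$ raises the weight $m-2l$ by $2$ and sends
  -- $f_m$ to a multiple of $f_{m-1}$.
  obtain ⟨c, hc⟩ : ∃ c : ℂ, Φ (matUnit 0 1) (stdVec m (Fin.last m)) =
      c • stdVec m ⟨m - 1, by omega⟩ := by
    refine ⟨_, eq_smul_of_weight _ ?_⟩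
    have h1 := hΦ.bracket_diag (matUnit 0 1)
    have h2 : (matUnit 0 0 - matUnit 1 1) * matUnit 0 1 - matUnit 0 1 * (matUnit 0 0 - matUnit 1 1)
        = (2 : ℂ) • matUnit 0 1 := by
      simp only [sub_mul, mul_sub, matUnit_mul]
      simp [two_smul]
    rw [h2, map_smul] at h1
    have h3 := congrArg (fun S => S (stdVec m (Fin.last m))) h1
    simp only [sub_apply, mul_apply_eq_comp, smul_apply] at h3
    rw [lieOp_weight, map_smul, eq_sub_iff_add_eq, ← add_smul] at h3
    rw [← h3]
    congr 1
    push_cast [Nat.cast_sub hm, Fin.val_last]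
    ring
  obtain ⟨n, rfl⟩ : ∃ n, m = n + 1 := ⟨m - 1, by omega⟩
  -- The ladder coefficient of `lieOp` from $f_m$ to $f_{m-1}$; $c/s$ is then the multiple of
  -- `lieOp` to subtract.
  set s : ℂ := ((√(((n + 1 : ℕ) : ℝ) * ((n + 1 - n : ℕ) : ℝ)) : ℝ) : ℂ) with hs
  have hs0 : s ≠ 0 := by
    rw [hs, Complex.ofReal_ne_zero, Real.sqrt_ne_zero']
    rw [Nat.add_sub_cancel_left]
    positivity
  obtain ⟨Ψ, hΨ⟩ : ∃ Ψ, Ψ = Φ + (-(c / s)) • lieOp (n + 1) := ⟨_, rfl⟩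
  have hE : IsEquivariant Ψ := hΨ ▸ hΦ.add ((isEquivariant_lieOp _).smul _)
  -- $E_{01}$ commutes with itself, so $\Psi(E_{01})$ commutes with the lowering operator and
  -- vanishes once it kills $f_m$.
  have h01 : Ψ (matUnit 0 1) = 0 := by
    apply eq_zero_of_commute_lower
    · rw [← hE.bracket_off_diag _ _ _ (by decide), sub_self, map_zero]
    · rw [hΨ, LinearMap.add_apply, LinearMap.smul_apply, add_apply, hc, smul_apply]
      have := lieOp_zero_one_succ (n + 1) n (by omega)
      change lieOp (n + 1) (matUnit 0 1) (stdVec (n + 1) (Fin.last (n + 1))) = _ at this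
      rw [this, ← hs, smul_smul, neg_mul, div_mul_cancel₀ _ hs0, neg_smul]
      exact add_neg_cancel _
  -- From $[E_{10},E_{01}]=E_{11}-E_{00}$.
  have hd : Ψ (matUnit 1 1) = Ψ (matUnit 0 0) := by
    have h1 := hE.bracket_off_diag (matUnit 0 1) 1 0 (by decide)
    rw [h01, mul_zero, zero_mul, sub_self, matUnit_mul, matUnit_mul, if_pos rfl, if_pos rfl,
      map_sub, sub_eq_zero] at h1
    exact h1
  -- From $[E_{10},E_{11}-E_{00}]=-2E_{10}$.
  have h10 : Ψ (matUnit 1 0) = 0 := by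
    have h1 := hE.bracket_off_diag (matUnit 1 1 - matUnit 0 0) 1 0 (by decide)
    rw [map_sub Ψ (matUnit 1 1), hd, sub_self, mul_zero, zero_mul, sub_self] at h1
    have h2 : matUnit 1 0 * (matUnit 1 1 - matUnit 0 0) - (matUnit 1 1 - matUnit 0 0) * matUnit 1 0
        = (-2 : ℂ) • matUnit 1 0 := by
      simp only [sub_mul, mul_sub, matUnit_mul]
      simp [two_smul, sub_eq_add_neg]
    rw [h2, map_smul] at h1
    exact (smul_eq_zero.1 h1).resolve_left (by norm_num)
  obtain ⟨β, hβ⟩ : ∃ β : ℂ, Ψ (matUnit 0 0) (stdVec (n + 1) (Fin.last (n + 1))) =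
      β • stdVec (n + 1) (Fin.last (n + 1)) := by
    refine ⟨_, eq_smul_of_weight _ ?_⟩
    have h1 := hE.bracket_diag (matUnit 0 0)
    have h2 : (matUnit 0 0 - matUnit 1 1) * matUnit 0 0 - matUnit 0 0 * (matUnit 0 0 - matUnit 1 1)
        = 0 := by
      simp only [sub_mul, mul_sub, matUnit_mul]
      simp
    rw [h2, map_zero] at h1
    have h3 := congrArg (fun S => S (stdVec (n + 1) (Fin.last (n + 1)))) h1
    simp only [sub_apply, mul_apply_eq_comp, zero_apply] at h3
    rw [lieOp_weight, map_smul, eq_comm, sub_eq_zero] at h3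
    exact h3
  -- $[E_{01},E_{00}]=-E_{01}$ is sent to $0$, so $\Psi(E_{00})$ also commutes with the lowering
  -- operator; $f_m$ is an eigenvector because its weight space is a line.
  have h00 : Ψ (matUnit 0 0) = β • 1 := by
    rw [← sub_eq_zero]
    apply eq_zero_of_commute_lower
    · have h1 := hE.bracket_off_diag (matUnit 0 0) 0 1 (by decide)
      rw [matUnit_mul, matUnit_mul, if_neg (by decide), if_pos rfl, zero_sub, map_neg, h01,
        neg_zero] at h1
      rw [mul_sub, sub_mul, mul_smul_comm, smul_mul_assoc, mul_one, one_mul, sub_sub_sub_cancel_right]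
      exact h1.symm
    · rw [sub_apply, hβ, smul_apply, one_apply_eq_self, sub_self]
  refine ⟨c / s, β, ?_⟩
  have hΦΨ : Φ = (c / s) • lieOp (n + 1) + Ψ := by
    ext1 A
    simp only [hΨ, LinearMap.add_apply, LinearMap.smul_apply, neg_smul]
    abel
  rw [hΦΨ]
  congr 1
  apply linearMap_ext_matUnit
  intro a b
  rw [LinearMap.smul_apply, traceOp_matUnit]
  fin_cases a <;> fin_cases b
  · exact h00
  · simpa using h01
  · simpa using h10
  · exact hd.trans h00

/-! ### Matrix entries and trace -/

theorem inner_lieOp_zero_one (m : ℕ) (k l : Fin (m + 1)) :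
    inner ℂ (stdVec m k) (lieOp m (matUnit 0 1) (stdVec m l)) =
      if (k : ℕ) + 1 = l then ((√(((k + 1 : ℕ) : ℝ) * ((m - k : ℕ) : ℝ)) : ℝ) : ℂ) else 0 := by
  obtain ⟨l, hl⟩ := l
  rcases l with _ | l
  · change inner ℂ (stdVec m k) (lieOp m (matUnit 0 1) (stdVec m 0)) = _
    rw [lieOp_zero_one_zero, inner_zero_right, if_neg (by simp)]
  · rw [lieOp_zero_one_succ m l (by omega), inner_smul_right, inner_stdVec_stdVec]
    by_cases h : (k : ℕ) = l
    · rw [if_pos (Fin.ext h), mul_one, if_pos (by simpa using h), h]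
    · rw [if_neg (fun h' => h (congrArg Fin.val h')), mul_zero, if_neg (by simpa using h)]

theorem inner_lieOp_one_zero (m : ℕ) (k l : Fin (m + 1)) :
    inner ℂ (stdVec m k) (lieOp m (matUnit 1 0) (stdVec m l)) =
      if (l : ℕ) + 1 = k then ((√(((l + 1 : ℕ) : ℝ) * ((m - l : ℕ) : ℝ)) : ℝ) : ℂ) else 0 := by
  obtain ⟨l, hl⟩ := l
  rcases Nat.lt_or_ge l m with h | h
  · rw [lieOp_one_zero_of_lt m l h, inner_smul_right, inner_stdVec_stdVec]
    by_cases h : l + 1 = (k : ℕ)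
    · rw [if_pos (Fin.ext h.symm), mul_one, if_pos h]
    · rw [if_neg (fun h' => h (congrArg Fin.val h').symm), mul_zero, if_neg h]
  · obtain rfl : l = m := by omega
    change inner ℂ (stdVec l k) (lieOp l (matUnit 1 0) (stdVec l (Fin.last l))) = _
    rw [lieOp_one_zero_last, inner_zero_right, if_neg]
    simp only
    omega

theorem sum_fin_cast (m : ℕ) : ∑ l : Fin (m + 1), (l : ℂ) = (m : ℂ) * (m + 1) / 2 := by
  have h : (∑ i ∈ Finset.range (m + 1), i) * 2 = (m + 1) * m := Finset.sum_range_id_mul_two _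
  rw [Fin.sum_univ_eq_sum_range (fun l => (l : ℂ))]
  have h' := congrArg (Nat.cast : ℕ → ℂ) h
  push_cast at h'
  linear_combination h' / 2

theorem trace_lieOp (m : ℕ) (A : HomPoly 1 →L[ℂ] HomPoly 1) :
    LinearMap.trace ℂ (HomPoly m) (lieOp m A : HomPoly m →ₗ[ℂ] HomPoly m) =
      (m : ℂ) * (m + 1) / 2 *
        LinearMap.trace ℂ (HomPoly 1) (A : HomPoly 1 →ₗ[ℂ] HomPoly 1) := by
  have key : LinearMap.trace ℂ (HomPoly m) ∘ₗ ContinuousLinearMap.coeLM ℂ ∘ₗ lieOp m =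
      ((m : ℂ) * (m + 1) / 2) • (LinearMap.trace ℂ (HomPoly 1) ∘ₗ ContinuousLinearMap.coeLM ℂ) := by
    apply linearMap_ext_matUnit
    intro a b
    change LinearMap.trace ℂ (HomPoly m)
      (lieOp m (matUnit a b) : HomPoly m →ₗ[ℂ] HomPoly m) = ((m : ℂ) * (m + 1) / 2) *
        LinearMap.trace ℂ (HomPoly 1) (matUnit a b : HomPoly 1 →ₗ[ℂ] HomPoly 1)
    rw [trace_matUnit, trace_eq_sum_inner]
    fin_cases a <;> fin_cases b
    · change ∑ l, inner ℂ (stdVec m l) (lieOp m (matUnit 0 0) (stdVec m l)) = _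
      simp only [lieOp_zero_zero, inner_smul_right, inner_stdVec_stdVec, if_true, mul_one,
        Finset.sum_sub_distrib, sum_fin_cast]
      simp
      ring
    · change ∑ l, inner ℂ (stdVec m l) (lieOp m (matUnit 0 1) (stdVec m l)) = _
      simp [inner_lieOp_zero_one]
    · change ∑ l, inner ℂ (stdVec m l) (lieOp m (matUnit 1 0) (stdVec m l)) = _
      simp [inner_lieOp_one_zero]
    · change ∑ l, inner ℂ (stdVec m l) (lieOp m (matUnit 1 1) (stdVec m l)) = _
      simp only [lieOp_one_one, inner_smul_right, inner_stdVec_stdVec, if_true, mul_one,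
        sum_fin_cast]
  exact LinearMap.congr_fun key A

theorem trace_traceOp (m : ℕ) (A : HomPoly 1 →L[ℂ] HomPoly 1) :
    LinearMap.trace ℂ (HomPoly m) (traceOp m A : HomPoly m →ₗ[ℂ] HomPoly m) =
      ((m : ℂ) + 1) * LinearMap.trace ℂ (HomPoly 1) (A : HomPoly 1 →ₗ[ℂ] HomPoly 1) := by
  rw [trace_eq_sum_inner]
  have (l : Fin (m + 1)) : inner ℂ (stdVec m l) (traceOp m A (stdVec m l)) =
      LinearMap.trace ℂ (HomPoly 1) (A : HomPoly 1 →ₗ[ℂ] HomPoly 1) := by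
    change inner ℂ (stdVec m l) (LinearMap.trace ℂ (HomPoly 1) (A : HomPoly 1 →ₗ[ℂ] HomPoly 1) •
      (stdVec m l)) = _
    rw [inner_smul_right, inner_stdVec_stdVec, if_pos rfl, mul_one]
  simp only [this]
  simp

end

noncomputable section

attribute [local instance] HomPoly.isTopologicalAddGroup HomPoly.continuousConstSMul

/-! ### Completely positive maps between operator algebras -/

section CompletelyPositive

open scoped CStarAlgebra

theorem exists_eq_star_mul_self {B : Type*} [NonUnitalCStarAlgebra B] [PartialOrder B]
    [StarOrderedRing B] {x : B} (hx : 0 ≤ x) : ∃ y, x = star y * y :=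
  CStarAlgebra.nonneg_iff_eq_star_mul_self.1 hx

theorem CStarMatrix.sum_apply {n ι B : Type*} [NonUnitalCStarAlgebra B] (s : Finset ι)
    (Z : ι → CStarMatrix n n B) (a b : n) : (∑ j ∈ s, Z j) a b = ∑ j ∈ s, Z j a b := by
  classical
  induction s using Finset.induction_on with
  | empty => simp
  | insert j s hj ih => rw [Finset.sum_insert hj, Finset.sum_insert hj, CStarMatrix.add_apply, ih]

variable {H K : Type*} [NormedAddCommGroup H] [InnerProductSpace ℂ H] [CompleteSpace H]
  [NormedAddCommGroup K] [InnerProductSpace ℂ K] [CompleteSpace K]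

/-- Writing a positive matrix as $N^*N$, its image is $\sum_j Z_j^*Z_j$ with $Z_j$ having entries
$VN_{ab}T_j^*$. The isometry `V` only serves to make these entries endomorphisms of `K`, so that the
factors lie in the same matrix algebra as the image; it cancels through $V^*V=1$. -/
theorem exists_completelyPositiveMap_of_kraus (V : H →L[ℂ] K)
    (hV : ContinuousLinearMap.adjoint V ∘L V = ContinuousLinearMap.id ℂ H) {ι : Type*}
    (s : Finset ι) (T : ι → H →L[ℂ] K) (Φ : (H →L[ℂ] H) →ₗ[ℂ] (K →L[ℂ] K))
    (hΦ : ∀ A, Φ A = ∑ j ∈ s, T j ∘L A ∘L ContinuousLinearMap.adjoint (T j)) :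
    ∃ φ : CompletelyPositiveMap (H →L[ℂ] H) (K →L[ℂ] K), φ.toLinearMap = Φ := by
  refine ⟨⟨Φ, fun k M hM => ?_⟩, rfl⟩
  obtain ⟨N, rfl⟩ := exists_eq_star_mul_self hM
  let Z : ι → CStarMatrix (Fin k) (Fin k) (K →L[ℂ] K) := fun j =>
    CStarMatrix.ofMatrix fun a b => V ∘L N a b ∘L ContinuousLinearMap.adjoint (T j)
  have hM : (star N * N).map Φ = ∑ j ∈ s, star (Z j) * Z j := by
    apply CStarMatrix.ext
    intro a b
    rw [CStarMatrix.map_apply, CStarMatrix.sum_apply, hΦ]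
    refine Finset.sum_congr rfl fun j _ => ?_
    rw [CStarMatrix.mul_apply, CStarMatrix.mul_apply, ContinuousLinearMap.finsetSum_comp,
      ContinuousLinearMap.comp_finsetSum]
    refine Finset.sum_congr rfl fun c _ => ?_
    change T j ∘L (ContinuousLinearMap.adjoint (N c a) ∘L N c b) ∘L
        ContinuousLinearMap.adjoint (T j) =
      ContinuousLinearMap.adjoint (V ∘L N c a ∘L ContinuousLinearMap.adjoint (T j)) ∘L
        (V ∘L N c b ∘L ContinuousLinearMap.adjoint (T j))
    ext x
    have hV' (y : H) : ContinuousLinearMap.adjoint V (V y) = y := DFunLike.congr_fun hV y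
    simp [ContinuousLinearMap.adjoint_comp, hV']
  rw [hM]
  exact Finset.sum_nonneg fun j _ => star_mul_self_nonneg _

/-- Positivity of the Choi form: the operator matrix $(e_ae_b^*)_{a,b}$ is positive, so its image is
$Y^*Y$ and the double sum becomes a sum of squared norms. -/
theorem CompletelyPositiveMap.sum_inner_nonneg
    (φ : CompletelyPositiveMap (H →L[ℂ] H) (K →L[ℂ] K)) {k : ℕ} (e : Fin (k + 1) → H)
    (he : ‖e 0‖ = 1) (v : Fin (k + 1) → K) :
    ∃ x : ℝ, 0 ≤ x ∧ ∑ a, ∑ b, inner ℂ (v a)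
      (φ.toLinearMap (InnerProductSpace.rankOne ℂ (e a) (e b)) (v b)) = x := by
  -- A single nonzero row, with entries $e_0e_b^*$: then $(N^*N)_{ab}=e_a(e_0^*e_0)e_b^*=e_ae_b^*$,
  -- which is where $\|e_0\|=1$ is used.
  let N : CStarMatrix (Fin (k + 1)) (Fin (k + 1)) (H →L[ℂ] H) :=
    CStarMatrix.ofMatrix fun a b => if a = 0 then InnerProductSpace.rankOne ℂ (e 0) (e b) else 0
  have hN (a b : Fin (k + 1)) :
      (star N * N) a b = InnerProductSpace.rankOne ℂ (e a) (e b) := by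
    rw [CStarMatrix.mul_apply, Finset.sum_eq_single 0]
    · change ContinuousLinearMap.adjoint (InnerProductSpace.rankOne ℂ (e 0) (e a)) ∘L
        InnerProductSpace.rankOne ℂ (e 0) (e b) = _
      rw [InnerProductSpace.adjoint_rankOne, InnerProductSpace.rankOne_comp_rankOne,
        inner_self_eq_norm_sq_to_K, he]
      simp
    · intro c _ hc
      have : N c b = 0 := if_neg hc
      rw [this, mul_zero]
    · simp
  have hpos := φ.map_cstarMatrix_nonneg' (k + 1) (star N * N) (star_mul_self_nonneg _)
  obtain ⟨Y, hY⟩ := exists_eq_star_mul_self hpos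
  have hY' (a b : Fin (k + 1)) : φ.toLinearMap (InnerProductSpace.rankOne ℂ (e a) (e b)) =
      ∑ c, star (Y c a) * Y c b := by
    rw [← hN, ← CStarMatrix.map_apply (f := φ.toLinearMap), hY, CStarMatrix.mul_apply]
    rfl
  have h1 : ∑ a, ∑ b, inner ℂ (v a)
      (φ.toLinearMap (InnerProductSpace.rankOne ℂ (e a) (e b)) (v b)) =
      ∑ c, inner ℂ (∑ a, Y c a (v a)) (∑ b, Y c b (v b)) := by
    simp only [hY', sum_apply, inner_sum, sum_inner, mul_apply_eq_comp,
      ContinuousLinearMap.star_eq_adjoint, ContinuousLinearMap.adjoint_inner_right]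
    rw [Finset.sum_comm, Finset.sum_comm_cycle]
  refine ⟨∑ c, ‖∑ a, Y c a (v a)‖ ^ 2, Finset.sum_nonneg fun c _ => sq_nonneg _, ?_⟩
  rw [h1, Complex.ofReal_sum]
  refine Finset.sum_congr rfl fun c _ => ?_
  rw [inner_self_eq_norm_sq_to_K]
  push_cast
  rfl

end CompletelyPositive

open HomPoly

theorem exists_isometry_of_one_le {m : ℕ} (hm : 1 ≤ m) : ∃ V : HomPoly 1 →L[ℂ] HomPoly m,
    ContinuousLinearMap.adjoint V ∘L V = ContinuousLinearMap.id ℂ (HomPoly 1) := by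
  let f : Fin 2 → Fin (m + 1) := Fin.castLE (by omega)
  let V : HomPoly 1 →L[ℂ] HomPoly m :=
    ∑ i : Fin 2, InnerProductSpace.rankOne ℂ (stdVec m (f i)) (stdVec 1 i)
  have hVapp (i : Fin 2) : V (stdVec 1 i) = stdVec m (f i) := by
    simp only [V, sum_apply, InnerProductSpace.rankOne_apply]
    rw [Finset.sum_eq_single i]
    · rw [inner_stdVec_stdVec, if_pos rfl, one_smul]
    · intro j _ hj
      rw [inner_stdVec_stdVec, if_neg hj, zero_smul]
    · simp
  refine ⟨V, ?_⟩
  apply clm_ext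
  intro i
  apply ext_inner_stdVec
  intro j
  rw [ContinuousLinearMap.comp_apply, ContinuousLinearMap.adjoint_inner_right]
  have h1 := hVapp i
  have h2 := hVapp j
  rw [h1, h2, inner_stdVec_stdVec, ContinuousLinearMap.id_apply, inner_stdVec_stdVec]
  simp only [f, Fin.castLE_inj]

/-! ### The EPOSIC channels as combinations of `lieOp` and `traceOp` -/

theorem inner_eposicKraus (m n h r j : ℕ) (l : Fin (m + 1)) (i : Fin (r + 1)) :
    inner ℂ (stdVec m l) (eposicKraus m n h r j (stdVec r i)) =
      if (l : ℕ) + j = i + h then (eposicEps m n h r i j : ℂ) else 0 := by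
  rw [eposicKraus, sum_apply, inner_sum, Finset.sum_eq_single i]
  · rw [sum_apply, inner_sum, Finset.sum_eq_single l]
    · split_ifs
      · rw [smul_apply, InnerProductSpace.rankOne_apply, inner_stdVec_stdVec, if_pos rfl, one_smul,
          inner_smul_right, inner_stdVec_stdVec, if_pos rfl, mul_one]
      · rw [zero_apply, inner_zero_right]
    · intro k _ hk
      split_ifs
      · rw [smul_apply, InnerProductSpace.rankOne_apply, inner_stdVec_stdVec, if_pos rfl, one_smul,
          inner_smul_right, inner_stdVec_stdVec, if_neg (Ne.symm hk), mul_zero]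
      · rw [zero_apply, inner_zero_right]
    · simp
  · intro k _ hk
    rw [sum_apply, inner_sum]
    refine Finset.sum_eq_zero fun l' _ => ?_
    split_ifs
    · rw [smul_apply, InnerProductSpace.rankOne_apply, inner_stdVec_stdVec, if_neg hk, zero_smul,
        smul_zero, inner_zero_right]
    · rw [zero_apply, inner_zero_right]
  · simp

theorem inner_eposicChannel_matUnit (m n h : ℕ) (a b : Fin 2) (k l : Fin (m + 1)) :
    inner ℂ (stdVec m k) (eposicChannel m n h 1 (matUnit a b) (stdVec m l)) =
      ∑ j ∈ Finset.range (n + 1), if (k : ℕ) + j = a + h ∧ (l : ℕ) + j = b + h then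
        ((eposicEps m n h 1 a j * eposicEps m n h 1 b j : ℝ) : ℂ) else 0 := by
  change inner ℂ (stdVec m k) ((∑ j ∈ Finset.range (n + 1), eposicKraus m n h 1 j ∘L
    matUnit a b ∘L ContinuousLinearMap.adjoint (eposicKraus m n h 1 j)) (stdVec m l)) = _
  rw [sum_apply, inner_sum]
  refine Finset.sum_congr rfl fun j _ => ?_
  rw [ContinuousLinearMap.comp_apply, ContinuousLinearMap.comp_apply, matUnit,
    InnerProductSpace.rankOne_apply, map_smul, inner_smul_right,
    ContinuousLinearMap.adjoint_inner_right, ← inner_conj_symm, inner_eposicKraus,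
    inner_eposicKraus]
  split_ifs <;> simp_all
  ring

end

noncomputable section

open HomPoly

attribute [local instance] HomPoly.isTopologicalAddGroup HomPoly.continuousConstSMul

/-! ### The coefficients of the two EPOSIC channels on `End(P_1)` -/

theorem div_sqrt_mul_eq_sqrt {x y N z : ℝ} (hx : 0 < x) (hy : 0 < y) (hN : 0 < N)
    (h : x = z * (y * N)) : x / √(y * x * N) = √z := by
  have hz : z = x ^ 2 / (y * x * N) := by
    rw [h]
    have : 0 < z := by
      rw [h] at hx
      exact pos_of_mul_pos_left hx (by positivity)
    field_simp
  rw [hz, Real.sqrt_div (by positivity), Real.sqrt_sq hx.le]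

theorem sum_range_add_one_cast (n : ℕ) :
    ∑ k ∈ Finset.range (n + 1), ((k : ℝ) + 1) = ((n : ℝ) + 1) * (n + 2) / 2 := by
  induction n with
  | zero => simp
  | succ n ih => rw [Finset.sum_range_succ, ih]; push_cast; ring

/-- The normalising sum in $\varepsilon_i^j$ for $(m,n,h)=(h+1,h,h)$; its terms are $(k+1)/(h+1)$.
-/
theorem sum_choose_sq_div_left (h : ℕ) :
    ∑ k ∈ Finset.range (h + 1),
      ((h.choose k : ℝ) ^ 2 / (((h + 1).choose (h - k) : ℝ) * (h.choose k))) = ((h : ℝ) + 2) / 2 := by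
  have key : ∀ k ∈ Finset.range (h + 1),
      ((h.choose k : ℝ) ^ 2 / (((h + 1).choose (h - k) : ℝ) * (h.choose k))) =
        ((k : ℝ) + 1) * (1 / ((h : ℝ) + 1)) := by
    intro k hk
    have hk' : k ≤ h := by simpa [Nat.lt_succ_iff] using hk
    have e : (h + 1).choose (h - k) = (h + 1).choose (k + 1) := by
      rw [← Nat.choose_symm (show k + 1 ≤ h + 1 by omega)]
      congr 1
      omega
    have h1 : ((h : ℝ) + 1) * h.choose k = (h + 1).choose (k + 1) * ((k : ℝ) + 1) := by
      exact_mod_cast Nat.add_one_mul_choose_eq h k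
    have h2 : (0 : ℝ) < h.choose k := by exact_mod_cast Nat.choose_pos hk'
    have h3 : (0 : ℝ) < (h + 1).choose (k + 1) := by exact_mod_cast Nat.choose_pos (by omega)
    rw [e]
    field_simp
    linear_combination h1
  rw [Finset.sum_congr rfl key, ← Finset.sum_mul, sum_range_add_one_cast]
  field_simp

/-- The normalising sum for $(m,m+1,m)$; its terms are $(m+1-k)/(m+1)$, summed in reverse order. -/
theorem sum_choose_sq_div_right (m : ℕ) :
    ∑ k ∈ Finset.range (m + 1),
      ((m.choose k : ℝ) ^ 2 / ((m.choose (m - k) : ℝ) * ((m + 1).choose k))) = ((m : ℝ) + 2) / 2 := by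
  have key : ∀ k ∈ Finset.range (m + 1),
      ((m.choose k : ℝ) ^ 2 / ((m.choose (m - k) : ℝ) * ((m + 1).choose k))) =
        (((m + 1 - 1 - k : ℕ) : ℝ) + 1) * (1 / ((m : ℝ) + 1)) := by
    intro k hk
    have hk' : k ≤ m := by simpa [Nat.lt_succ_iff] using hk
    have h1 : (m.choose k : ℝ) * ((m : ℝ) + 1) = (m + 1).choose k * ((m : ℝ) + 1 - k) := by
      have := Nat.choose_mul_succ_eq m k
      have h4 : ((m + 1 - k : ℕ) : ℝ) = (m : ℝ) + 1 - k := by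
        rw [Nat.cast_sub (by omega)]; push_cast; ring
      rw [← h4]
      exact_mod_cast this
    have h2 : (0 : ℝ) < m.choose k := by exact_mod_cast Nat.choose_pos hk'
    have h3 : (0 : ℝ) < (m + 1).choose k := by exact_mod_cast Nat.choose_pos (by omega)
    rw [Nat.choose_symm hk', Nat.add_sub_cancel, Nat.cast_sub hk']
    field_simp
    linear_combination h1
  rw [Finset.sum_congr rfl key, ← Finset.sum_mul,
    Finset.sum_range_reflect (fun k => (k : ℝ) + 1) (m + 1), sum_range_add_one_cast]
  field_simp

/-- As in the next three lemmas, the range of $s$ collapses to one point because $n-h$ and $m-h$ are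
$0$ and $1$ in some order; one binomial cancels against the square root. -/
theorem eposicEps_lower_zero (h j : ℕ) (hj : j ≤ h) :
    eposicEps (h + 1) h h 1 0 j = (-1) ^ j * √(2 * ((j : ℝ) + 1) / (((h : ℝ) + 1) * (h + 2))) := by
  have hI : Finset.Icc (max (j - 0) (j + h - h)) (min (min h j) (j + (h + 1) - (0 + h))) = {j} := by
    ext x; simp only [Finset.mem_Icc, Finset.mem_singleton]; omega
  have h1 : ((h : ℝ) + 1) * h.choose j = (h + 1).choose (j + 1) * ((j : ℝ) + 1) := by
    exact_mod_cast Nat.add_one_mul_choose_eq h j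
  have h2 : (0 : ℝ) < h.choose j := by exact_mod_cast Nat.choose_pos hj
  have h3 : (0 : ℝ) < (h + 1).choose (j + 1) := by exact_mod_cast Nat.choose_pos (by omega)
  have e : (h + 1).choose (0 + h - j) = (h + 1).choose (j + 1) := by
    rw [← Nat.choose_symm (show j + 1 ≤ h + 1 by omega)]
    congr 1
    omega
  rw [eposicEps, hI, Finset.sum_singleton, eposicBeta, sum_choose_sq_div_left, e]
  simp only [Nat.sub_self, Nat.choose_zero_right, Nat.cast_one, mul_one, zero_add, one_mul]
  rw [mul_div_assoc, div_sqrt_mul_eq_sqrt h2 h3 (by positivity)]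
  field_simp
  linear_combination h1

theorem eposicEps_lower_one (h j : ℕ) (hj : j ≤ h) :
    eposicEps (h + 1) h h 1 1 j =
      (-1) ^ j * √(2 * ((h : ℝ) + 1 - j) / (((h : ℝ) + 1) * (h + 2))) := by
  have hI : Finset.Icc (max (j - 1) (j + h - h)) (min (min h j) (j + (h + 1) - (1 + h))) = {j} := by
    ext x; simp only [Finset.mem_Icc, Finset.mem_singleton]; omega
  have h1 : (h.choose j : ℝ) * ((h : ℝ) + 1) = (h + 1).choose j * ((h : ℝ) + 1 - j) := by
    have h4 : ((h + 1 - j : ℕ) : ℝ) = (h : ℝ) + 1 - j := by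
      rw [Nat.cast_sub (by omega)]; push_cast; ring
    rw [← h4]
    exact_mod_cast Nat.choose_mul_succ_eq h j
  have h2 : (0 : ℝ) < h.choose j := by exact_mod_cast Nat.choose_pos hj
  have h3 : (0 : ℝ) < (h + 1).choose j := by exact_mod_cast Nat.choose_pos (by omega)
  have e : (h + 1).choose (1 + h - j) = (h + 1).choose j := by
    rw [← Nat.choose_symm (show j ≤ h + 1 by omega)]
    congr 1
    omega
  rw [eposicEps, hI, Finset.sum_singleton, eposicBeta, sum_choose_sq_div_left, e]
  simp only [Nat.sub_self, Nat.cast_one, mul_one, one_mul, Nat.add_sub_cancel, Nat.add_sub_cancel_left, Nat.choose_self]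
  rw [mul_div_assoc, div_sqrt_mul_eq_sqrt h2 h3 (by positivity)]
  field_simp
  linear_combination h1

theorem eposicEps_upper_zero (m j : ℕ) (hj : j ≤ m) :
    eposicEps m (m + 1) m 1 0 j =
      (-1) ^ j * √(2 * ((m : ℝ) + 1 - j) / (((m : ℝ) + 1) * (m + 2))) := by
  have hI : Finset.Icc (max (j - 0) (j + m - (m + 1))) (min (min m j) (j + m - (0 + m))) = {j} := by
    ext x; simp only [Finset.mem_Icc, Finset.mem_singleton]; omega
  have h1 : (m.choose j : ℝ) * ((m : ℝ) + 1) = (m + 1).choose j * ((m : ℝ) + 1 - j) := by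
    have h4 : ((m + 1 - j : ℕ) : ℝ) = (m : ℝ) + 1 - j := by
      rw [Nat.cast_sub (by omega)]; push_cast; ring
    rw [← h4]
    exact_mod_cast Nat.choose_mul_succ_eq m j
  have h2 : (0 : ℝ) < m.choose j := by exact_mod_cast Nat.choose_pos hj
  have h3 : (0 : ℝ) < (m + 1).choose j := by exact_mod_cast Nat.choose_pos (by omega)
  rw [eposicEps, hI, Finset.sum_singleton, eposicBeta, sum_choose_sq_div_right,
    zero_add m, Nat.choose_symm hj]
  simp only [Nat.sub_self, Nat.choose_zero_right, Nat.cast_one, mul_one, one_mul, zero_add]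
  rw [mul_div_assoc, mul_comm (m.choose j : ℝ) ((m + 1).choose j : ℝ),
    div_sqrt_mul_eq_sqrt h2 h3 (by positivity)]
  field_simp
  linear_combination h1

/-- The index is shifted to $j+1$ while the sign is still $(-1)^j$, since the only admissible $s$ is
$j$. This relative sign against `eposicEps_upper_zero` produces the minus sign before `lieOp` in
`eposicChannel_upper`. -/
theorem eposicEps_upper_one (m j : ℕ) (hj : j ≤ m) :
    eposicEps m (m + 1) m 1 1 (j + 1) =
      (-1) ^ j * √(2 * ((j : ℝ) + 1) / (((m : ℝ) + 1) * (m + 2))) := by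
  have hI : Finset.Icc (max (j + 1 - 1) (j + 1 + m - (m + 1)))
      (min (min m (j + 1)) (j + 1 + m - (1 + m))) = {j} := by
    ext x; simp only [Finset.mem_Icc, Finset.mem_singleton]; omega
  have h1 : ((m : ℝ) + 1) * m.choose j = (m + 1).choose (j + 1) * ((j : ℝ) + 1) := by
    exact_mod_cast Nat.add_one_mul_choose_eq m j
  have h2 : (0 : ℝ) < m.choose j := by exact_mod_cast Nat.choose_pos hj
  have h3 : (0 : ℝ) < (m + 1).choose (j + 1) := by exact_mod_cast Nat.choose_pos (by omega)
  have e1 : 1 + m - (j + 1) = m - j := by omega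
  have e2 : 1 + j - (j + 1) = 0 := by omega
  rw [eposicEps, hI, Finset.sum_singleton, eposicBeta, sum_choose_sq_div_right, e1, e2,
    Nat.choose_symm hj]
  simp only [Nat.add_sub_cancel_left, Nat.choose_self, Nat.choose_zero_right, Nat.cast_one,
    mul_one, one_mul]
  rw [mul_div_assoc, mul_comm (m.choose j : ℝ) ((m + 1).choose (j + 1) : ℝ),
    div_sqrt_mul_eq_sqrt h2 h3 (by positivity)]
  field_simp
  linear_combination h1

theorem sqrt_two_mul_div_mul {x y D : ℝ} (hx : 0 ≤ x) (hD : 0 < D) :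
    √(2 * x / D) * √(2 * y / D) = 2 / D * √(x * y) := by
  rw [← Real.sqrt_mul (by positivity)]
  have : 2 * x / D * (2 * y / D) = (2 / D) ^ 2 * (x * y) := by field_simp
  rw [this, Real.sqrt_mul (by positivity), Real.sqrt_sq (by positivity)]

theorem neg_one_pow_mul_neg_one_pow (j : ℕ) (x y : ℝ) :
    (-1) ^ j * x * ((-1) ^ j * y) = x * y := by
  have : ((-1 : ℝ) ^ j) * (-1) ^ j = 1 := by rw [← mul_pow]; simp
  linear_combination (x * y) * this

theorem sum_range_ite_and (n k l A B : ℕ) (F : ℕ → ℂ) :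
    (∑ j ∈ Finset.range (n + 1), if k + j = A ∧ l + j = B then F j else 0) =
      if k ≤ A ∧ A ≤ k + n ∧ A + l = B + k then F (A - k) else 0 := by
  split_ifs with h
  · rw [Finset.sum_eq_single (A - k)]
    · rw [if_pos (by omega)]
    · intro j _ hj
      rw [if_neg (by omega)]
    · intro h'
      rw [Finset.mem_range] at h'
      omega
  · refine Finset.sum_eq_zero fun j hj => if_neg ?_
    rw [Finset.mem_range] at hj
    omega

theorem inner_eposicChannel_matUnit' (m n h : ℕ) (a b : Fin 2) (k l : Fin (m + 1)) :
    inner ℂ (stdVec m k) (eposicChannel m n h 1 (matUnit a b) (stdVec m l)) =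
      if (k : ℕ) ≤ a + h ∧ a + h ≤ k + n ∧ a + h + l = b + h + k then
        ((eposicEps m n h 1 a (a + h - k) * eposicEps m n h 1 b (a + h - k) : ℝ) : ℂ) else 0 := by
  rw [inner_eposicChannel_matUnit, sum_range_ite_and]

theorem eq_of_inner_matUnit {m : ℕ}
    {Φ Ψ : (HomPoly 1 →L[ℂ] HomPoly 1) →ₗ[ℂ] (HomPoly m →L[ℂ] HomPoly m)}
    (h : ∀ a b k l, inner ℂ (stdVec m k) (Φ (matUnit a b) (stdVec m l)) =
      inner ℂ (stdVec m k) (Ψ (matUnit a b) (stdVec m l))) : Φ = Ψ :=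
  linearMap_ext_matUnit fun a b => clm_ext fun l => ext_inner_stdVec fun k => h a b k l

theorem inner_lieOp_zero_zero (m : ℕ) (k l : Fin (m + 1)) :
    inner ℂ (stdVec m k) (lieOp m (matUnit 0 0) (stdVec m l)) =
      if (k : ℕ) = l then ((((m - k : ℕ) : ℝ)) : ℂ) else 0 := by
  rw [lieOp_zero_zero, inner_smul_right, inner_stdVec_stdVec]
  simp only [Fin.ext_iff]
  split_ifs with h
  · rw [h, Nat.cast_sub (by omega)]; push_cast; ring
  · rw [mul_zero]

theorem inner_lieOp_one_one (m : ℕ) (k l : Fin (m + 1)) :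
    inner ℂ (stdVec m k) (lieOp m (matUnit 1 1) (stdVec m l)) =
      if (k : ℕ) = l then ((((k : ℕ) : ℝ)) : ℂ) else 0 := by
  rw [lieOp_one_one, inner_smul_right, inner_stdVec_stdVec]
  simp only [Fin.ext_iff]
  split_ifs with h
  · rw [h]; push_cast; ring
  · rw [mul_zero]

/-- Compared entry by entry: each entry receives at most one Kraus term, and the product of its two
square roots is the diagonal weight or ladder coefficient of `lieOp`. -/
theorem eposicChannel_lower (h : ℕ) :
    eposicChannel (h + 1) h h 1 =
      ((2 / (((h : ℝ) + 1) * (h + 2)) : ℝ) : ℂ) • lieOp (h + 1) := by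
  apply eq_of_inner_matUnit
  intro a b k l
  have hD : 0 < ((h : ℝ) + 1) * (h + 2) := by positivity
  have hk := k.2
  have hl := l.2
  rw [inner_eposicChannel_matUnit', LinearMap.smul_apply, smul_apply, inner_smul_right]
  fin_cases a <;> fin_cases b
  · change (if (k : ℕ) ≤ 0 + h ∧ 0 + h ≤ k + h ∧ 0 + h + l = 0 + h + k then
        ((eposicEps (h + 1) h h 1 0 (0 + h - k) * eposicEps (h + 1) h h 1 0 (0 + h - k) : ℝ) : ℂ)
        else 0) = _ * inner ℂ (stdVec _ k) (lieOp (h + 1) (matUnit 0 0) (stdVec _ l))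
    rw [inner_lieOp_zero_zero]
    by_cases hkl : (k : ℕ) = l
    · rw [if_pos hkl]
      by_cases hkh : (k : ℕ) ≤ h
      · rw [if_pos (by omega), eposicEps_lower_zero _ _ (by omega), neg_one_pow_mul_neg_one_pow,
          sqrt_two_mul_div_mul (by positivity) hD, Real.sqrt_mul_self (by positivity),
          ← Complex.ofReal_mul]
        congr 2
        have : h + 1 - k = 0 + h - k + 1 := by omega
        rw [this]; push_cast; ring
      -- Row $k=h+1$: no Kraus operator contributes, matching the weight $h+1-k=0$.
      · rw [if_neg (by omega)]
        have : h + 1 - k = 0 := by omega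
        rw [this]; simp
    · rw [if_neg hkl, if_neg (by omega), mul_zero]
  · change (if (k : ℕ) ≤ 0 + h ∧ 0 + h ≤ k + h ∧ 0 + h + l = 1 + h + k then
        ((eposicEps (h + 1) h h 1 0 (0 + h - k) * eposicEps (h + 1) h h 1 1 (0 + h - k) : ℝ) : ℂ)
        else 0) = _ * inner ℂ (stdVec _ k) (lieOp (h + 1) (matUnit 0 1) (stdVec _ l))
    rw [inner_lieOp_zero_one]
    by_cases hkl : (k : ℕ) + 1 = l
    · rw [if_pos hkl, if_pos (by omega), eposicEps_lower_zero _ _ (by omega),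
        eposicEps_lower_one _ _ (by omega), neg_one_pow_mul_neg_one_pow,
        sqrt_two_mul_div_mul (by positivity) hD, ← Complex.ofReal_mul]
      congr 3
      have e1 : h + 1 - k = 0 + h - k + 1 := by omega
      have e2 : ((0 + h - k : ℕ) : ℝ) = h - k := by rw [zero_add, Nat.cast_sub (by omega)]
      rw [e1]; push_cast [e2]; ring
    · rw [if_neg hkl, if_neg (by omega), mul_zero]
  · change (if (k : ℕ) ≤ 1 + h ∧ 1 + h ≤ k + h ∧ 1 + h + l = 0 + h + k then
        ((eposicEps (h + 1) h h 1 1 (1 + h - k) * eposicEps (h + 1) h h 1 0 (1 + h - k) : ℝ) : ℂ)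
        else 0) = _ * inner ℂ (stdVec _ k) (lieOp (h + 1) (matUnit 1 0) (stdVec _ l))
    rw [inner_lieOp_one_zero]
    by_cases hkl : (l : ℕ) + 1 = k
    · rw [if_pos hkl, if_pos (by omega), eposicEps_lower_zero _ _ (by omega),
        eposicEps_lower_one _ _ (by omega), neg_one_pow_mul_neg_one_pow,
        mul_comm, sqrt_two_mul_div_mul (by positivity) hD, ← Complex.ofReal_mul]
      congr 3
      have e1 : h + 1 - l = h - l + 1 := by omega
      have e2 : ((h - l : ℕ) : ℝ) = h - l := by rw [Nat.cast_sub (by omega)]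
      have e3 : 1 + h - k = h - l := by omega
      rw [e1, e3]; push_cast [e2]; ring
    · rw [if_neg hkl, if_neg (by omega), mul_zero]
  · change (if (k : ℕ) ≤ 1 + h ∧ 1 + h ≤ k + h ∧ 1 + h + l = 1 + h + k then
        ((eposicEps (h + 1) h h 1 1 (1 + h - k) * eposicEps (h + 1) h h 1 1 (1 + h - k) : ℝ) : ℂ)
        else 0) = _ * inner ℂ (stdVec _ k) (lieOp (h + 1) (matUnit 1 1) (stdVec _ l))
    rw [inner_lieOp_one_one]
    by_cases hkl : (k : ℕ) = l
    · rw [if_pos hkl]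
      by_cases hkh : 1 ≤ (k : ℕ)
      · have e1 : (h : ℝ) + 1 - ((1 + h - k : ℕ) : ℝ) = k := by
          rw [Nat.cast_sub (by omega)]; push_cast; ring
        rw [if_pos (by omega), eposicEps_lower_one _ _ (by omega), neg_one_pow_mul_neg_one_pow, e1,
          sqrt_two_mul_div_mul (by positivity) hD, Real.sqrt_mul_self (by positivity),
          ← Complex.ofReal_mul]
      · rw [if_neg (by omega)]
        have : (k : ℕ) = 0 := by omega
        rw [this]; simp
    · rw [if_neg hkl, if_neg (by omega), mul_zero]

theorem inner_traceOp_self (m : ℕ) (a : Fin 2) (k l : Fin (m + 1)) :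
    inner ℂ (stdVec m k) (traceOp m (matUnit a a) (stdVec m l)) =
      if (k : ℕ) = l then (1 : ℂ) else 0 := by
  rw [traceOp_matUnit, if_pos rfl, one_apply_eq_self, inner_stdVec_stdVec]
  simp only [Fin.ext_iff]

theorem inner_traceOp_of_ne (m : ℕ) {a b : Fin 2} (hab : a ≠ b) (k l : Fin (m + 1)) :
    inner ℂ (stdVec m k) (traceOp m (matUnit a b) (stdVec m l)) = 0 := by
  rw [traceOp_matUnit, if_neg hab, zero_apply, inner_zero_right]

theorem neg_one_pow_mul_neg_one_pow_succ (j : ℕ) (x y : ℝ) :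
    (-1) ^ (j + 1) * x * ((-1) ^ j * y) = -(x * y) := by
  rw [pow_succ]
  linear_combination -neg_one_pow_mul_neg_one_pow j x y

/-- The signs cancel on the diagonal, where the entries are the complements $(m+1)-(m-k)$ and
$(m+1)-k$ of the weights; off the diagonal they leave the negative of the ladder coefficient. -/
theorem eposicChannel_upper (m : ℕ) :
    eposicChannel m (m + 1) m 1 =
      ((2 / (((m : ℝ) + 1) * (m + 2)) : ℝ) : ℂ) • (((m : ℂ) + 1) • traceOp m - lieOp m) := by
  apply eq_of_inner_matUnit
  intro a b k l
  have hD : 0 < ((m : ℝ) + 1) * (m + 2) := by positivity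
  have hk := k.2
  have hl := l.2
  rw [inner_eposicChannel_matUnit', LinearMap.smul_apply, smul_apply, inner_smul_right,
    LinearMap.sub_apply, sub_apply, inner_sub_right, LinearMap.smul_apply, smul_apply,
    inner_smul_right]
  fin_cases a <;> fin_cases b
  · change (if (k : ℕ) ≤ 0 + m ∧ 0 + m ≤ k + (m + 1) ∧ 0 + m + l = 0 + m + k then
        ((eposicEps m (m + 1) m 1 0 (0 + m - k) * eposicEps m (m + 1) m 1 0 (0 + m - k) : ℝ) : ℂ)
        else 0) = _ * (_ * inner ℂ (stdVec _ k) (traceOp m (matUnit 0 0) (stdVec _ l)) -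
          inner ℂ (stdVec _ k) (lieOp m (matUnit 0 0) (stdVec _ l)))
    rw [inner_lieOp_zero_zero, inner_traceOp_self]
    by_cases hkl : (k : ℕ) = l
    · have e1 : (m : ℝ) + 1 - ((0 + m - k : ℕ) : ℝ) = k + 1 := by
        rw [Nat.cast_sub (by omega)]; push_cast; ring
      rw [if_pos hkl, if_pos (by omega), if_pos hkl, eposicEps_upper_zero _ _ (by omega),
        neg_one_pow_mul_neg_one_pow, e1, sqrt_two_mul_div_mul (by positivity) hD,
        Real.sqrt_mul_self (by positivity), Complex.ofReal_mul, Nat.cast_sub (by omega)]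
      push_cast
      ring
    · rw [if_neg hkl, if_neg (by omega), if_neg hkl]; ring
  · change (if (k : ℕ) ≤ 0 + m ∧ 0 + m ≤ k + (m + 1) ∧ 0 + m + l = 1 + m + k then
        ((eposicEps m (m + 1) m 1 0 (0 + m - k) * eposicEps m (m + 1) m 1 1 (0 + m - k) : ℝ) : ℂ)
        else 0) = _ * (_ * inner ℂ (stdVec _ k) (traceOp m (matUnit 0 1) (stdVec _ l)) -
          inner ℂ (stdVec _ k) (lieOp m (matUnit 0 1) (stdVec _ l)))
    rw [inner_lieOp_zero_one, inner_traceOp_of_ne m (by decide)]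
    by_cases hkl : (k : ℕ) + 1 = l
    · obtain ⟨j, hj⟩ : ∃ j, 0 + m - k = j + 1 := ⟨0 + m - k - 1, by omega⟩
      have e1 : (m : ℝ) + 1 - ((j + 1 : ℕ) : ℝ) = ((k + 1 : ℕ) : ℝ) := by
        have : (m : ℝ) = j + 1 + k := by exact_mod_cast (by omega : m = j + 1 + k)
        rw [this]; push_cast; ring
      have e2 : m - k = j + 1 := by omega
      rw [if_pos (by omega), if_pos hkl, hj, eposicEps_upper_zero _ _ (by omega),
        eposicEps_upper_one _ _ (by omega), neg_one_pow_mul_neg_one_pow_succ, e1, e2,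
        sqrt_two_mul_div_mul (by positivity) hD]
      push_cast
      ring
    · rw [if_neg hkl, if_neg (by omega)]; ring
  · change (if (k : ℕ) ≤ 1 + m ∧ 1 + m ≤ k + (m + 1) ∧ 1 + m + l = 0 + m + k then
        ((eposicEps m (m + 1) m 1 1 (1 + m - k) * eposicEps m (m + 1) m 1 0 (1 + m - k) : ℝ) : ℂ)
        else 0) = _ * (_ * inner ℂ (stdVec _ k) (traceOp m (matUnit 1 0) (stdVec _ l)) -
          inner ℂ (stdVec _ k) (lieOp m (matUnit 1 0) (stdVec _ l)))
    rw [inner_lieOp_one_zero, inner_traceOp_of_ne m (by decide)]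
    by_cases hkl : (l : ℕ) + 1 = k
    · obtain ⟨j, hj⟩ : ∃ j, 1 + m - k = j + 1 := ⟨1 + m - k - 1, by omega⟩
      have e1 : (m : ℝ) + 1 - ((j + 1 : ℕ) : ℝ) = ((l + 1 : ℕ) : ℝ) := by
        have : (m : ℝ) = j + 1 + l := by exact_mod_cast (by omega : m = j + 1 + l)
        rw [this]; push_cast; ring
      have e2 : m - l = j + 1 := by omega
      rw [if_pos (by omega), if_pos hkl, hj, mul_comm (eposicEps _ _ _ _ _ _),
        eposicEps_upper_zero _ _ (by omega), eposicEps_upper_one _ _ (by omega),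
        neg_one_pow_mul_neg_one_pow_succ, e1, e2, sqrt_two_mul_div_mul (by positivity) hD]
      push_cast
      ring
    · rw [if_neg hkl, if_neg (by omega)]; ring
  · change (if (k : ℕ) ≤ 1 + m ∧ 1 + m ≤ k + (m + 1) ∧ 1 + m + l = 1 + m + k then
        ((eposicEps m (m + 1) m 1 1 (1 + m - k) * eposicEps m (m + 1) m 1 1 (1 + m - k) : ℝ) : ℂ)
        else 0) = _ * (_ * inner ℂ (stdVec _ k) (traceOp m (matUnit 1 1) (stdVec _ l)) -
          inner ℂ (stdVec _ k) (lieOp m (matUnit 1 1) (stdVec _ l)))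
    rw [inner_lieOp_one_one, inner_traceOp_self]
    by_cases hkl : (k : ℕ) = l
    · have e1 : 1 + m - k = m - k + 1 := by omega
      rw [if_pos hkl, if_pos (by omega), if_pos hkl, e1, eposicEps_upper_one _ _ (by omega),
        neg_one_pow_mul_neg_one_pow, sqrt_two_mul_div_mul (by positivity) hD,
        Real.sqrt_mul_self (by positivity), Complex.ofReal_mul, Nat.cast_sub (by omega)]
      push_cast
      ring
    · rw [if_neg hkl, if_neg (by omega), if_neg hkl]; ring

end

noncomputable section

open HomPoly

attribute [local instance] HomPoly.isTopologicalAddGroup HomPoly.continuousConstSMul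

/-! ### The entropy of an operator with a known eigenbasis -/

section Entropy

variable {H : Type*} [NormedAddCommGroup H] [InnerProductSpace ℂ H]

theorem aeval_apply_of_apply_eq_smul {T : H →L[ℂ] H} {v : H} {c : ℝ} (h : T v = (c : ℂ) • v)
    (q : Polynomial ℝ) : Polynomial.aeval T q v = ((q.eval c : ℝ) : ℂ) • v := by
  induction q using Polynomial.induction_on' with
  | add p q hp hq =>
    rw [map_add, add_apply, hp, hq, Polynomial.eval_add, Complex.ofReal_add, add_smul]
  | monomial n a =>
    have hpow : (T ^ n) v = ((c ^ n : ℝ) : ℂ) • v := by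
      induction n with
      | zero => simp
      | succ n ih =>
        rw [pow_succ', mul_apply_eq_comp, ih, map_smul, h, smul_smul, ← Complex.ofReal_mul,
          ← pow_succ]
    rw [Polynomial.aeval_monomial, mul_apply_eq_comp, hpow, Polynomial.eval_monomial,
      Algebra.algebraMap_eq_smul_one, smul_apply, one_apply_eq_self, Complex.ofReal_mul, mul_smul]
    exact (Complex.coe_smul a _).symm

variable {ι : Type*} [Fintype ι]

theorem clm_ext_orthonormalBasis (b : OrthonormalBasis ι ℂ H) {S T : H →L[ℂ] H}
    (h : ∀ i, S (b i) = T (b i)) : S = T := by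
  apply ContinuousLinearMap.coe_injective
  apply b.toBasis.ext
  intro i
  simpa using h i

/-- $\prod_i(X-c_i)$ annihilates `T`, so every point of the spectrum is a root of it. -/
theorem spectrum_subset_of_eigenbasis (b : OrthonormalBasis ι ℂ H) {T : H →L[ℂ] H} {c : ι → ℝ}
    (h : ∀ i, T (b i) = (c i : ℂ) • b i) : spectrum ℝ T ⊆ Set.range c := by
  intro x hx
  let q : Polynomial ℝ := ∏ i, (Polynomial.X - Polynomial.C (c i))
  have hq : Polynomial.aeval T q = 0 := by
    apply clm_ext_orthonormalBasis b
    intro i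
    rw [aeval_apply_of_apply_eq_smul (h i), Polynomial.eval_prod,
      Finset.prod_eq_zero (Finset.mem_univ i) (by simp)]
    simp
  have hmem := spectrum.subset_polynomial_aeval T q ⟨x, hx, rfl⟩
  rw [hq] at hmem
  -- On the zero space the spectrum is empty, so a point of it forces the algebra to be nontrivial.
  have hne : Nontrivial (H →L[ℂ] H) := by
    by_contra hn
    rw [not_nontrivial_iff_subsingleton] at hn
    rw [spectrum.of_subsingleton] at hmem
    exact hmem
  rw [spectrum.zero_eq, Set.mem_singleton_iff] at hmem
  change Polynomial.eval x q = 0 at hmem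
  rw [Polynomial.eval_prod, Finset.prod_eq_zero_iff] at hmem
  obtain ⟨i, -, hi⟩ := hmem
  exact ⟨i, by simpa [sub_eq_zero, eq_comm] using hi⟩

variable [CompleteSpace H]

theorem isSelfAdjoint_of_eigenbasis (b : OrthonormalBasis ι ℂ H) {T : H →L[ℂ] H} {c : ι → ℝ}
    (h : ∀ i, T (b i) = (c i : ℂ) • b i) : IsSelfAdjoint T := by
  rw [ContinuousLinearMap.isSelfAdjoint_iff']
  apply clm_ext_orthonormalBasis b
  intro j
  apply InnerProductSpace.ext_inner_left_basis b.toBasis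
  intro i
  rw [OrthonormalBasis.coe_toBasis, ContinuousLinearMap.adjoint_inner_right, h, h, inner_smul_left,
    inner_smul_right, Complex.conj_ofReal]
  classical
  rw [orthonormal_iff_ite.1 b.orthonormal]
  split_ifs with hij
  · rw [hij]
  · simp

/-- On the finite spectrum `f` agrees with its Lagrange interpolation polynomial, for which the
functional calculus is plain evaluation. No continuity of `f` is required. -/
theorem cfc_apply_of_eigenbasis (b : OrthonormalBasis ι ℂ H) {T : H →L[ℂ] H} {c : ι → ℝ}
    (h : ∀ i, T (b i) = (c i : ℂ) • b i) (f : ℝ → ℝ) (i : ι) :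
    cfc f T (b i) = (f (c i) : ℂ) • b i := by
  classical
  have hT := isSelfAdjoint_of_eigenbasis b h
  let q : Polynomial ℝ := Lagrange.interpolate (Finset.univ.image c) id f
  have hq (i : ι) : q.eval (c i) = f (c i) :=
    Lagrange.eval_interpolate_at_node f (Set.injOn_id _)
      (Finset.mem_image_of_mem c (Finset.mem_univ i))
  have hEq : (spectrum ℝ T).EqOn f q.eval := by
    intro x hx
    obtain ⟨i, rfl⟩ := spectrum_subset_of_eigenbasis b h hx
    exact (hq i).symm
  rw [cfc_congr hEq, cfc_polynomial q T hT, aeval_apply_of_apply_eq_smul (h i), hq]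

theorem vonNeumannEntropy_of_eigenbasis (b : OrthonormalBasis ι ℂ H) {T : H →L[ℂ] H} {c : ι → ℝ}
    (h : ∀ i, T (b i) = (c i : ℂ) • b i) :
    vonNeumannEntropy T = -∑ i, c i * Real.logb 2 (c i) := by
  rw [vonNeumannEntropy, LinearMap.trace_eq_sum_inner _ b, Complex.re_sum]
  congr 1
  refine Finset.sum_congr rfl fun i _ => ?_
  rw [ContinuousLinearMap.coe_coe, cfc_apply_of_eigenbasis b h, inner_smul_right,
    inner_self_eq_norm_sq_to_K, b.norm_eq_one]
  simp

end Entropy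

/-! ### Pure states of `P_1` -/

theorem exists_su2Op_apply_eq (w : HomPoly 1) (hw : ‖w‖ = 1) :
    ∃ g : SU2, su2Op 1 g (stdVec 1 0) = w := by
  have h1 := (stdBasis 1).sum_sq_norm_inner_right w
  rw [hw] at h1
  simp only [stdBasis_apply] at h1
  change ∑ i : Fin 2, ‖inner ℂ (stdVec 1 i) w‖ ^ 2 = 1 ^ 2 at h1
  rw [Fin.sum_univ_two, ← Complex.normSq_eq_norm_sq, ← Complex.normSq_eq_norm_sq] at h1
  -- $f^1_0=x_2$ is sent to the combination of $x_1,x_2$ given by the second column $(-\bar b,\bar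
  -- a)$, which has to be $(w_1,w_0)$.
  refine ⟨SU2.ofColumn (conj (inner ℂ (stdVec 1 0) w)) (-conj (inner ℂ (stdVec 1 1) w)) ?_, ?_⟩
  · rw [Complex.normSq_conj, Complex.normSq_neg, Complex.normSq_conj, h1]
    norm_num
  · apply toPoly_injective
    rw [toPoly_su2Op, toPoly_stdVec_one_zero, linSubst_X, SU2.coe_ofColumn]
    conv_rhs => rw [← sum_inner_smul_stdVec 1 w]
    change _ = toPoly 1 (∑ l : Fin 2, inner ℂ (stdVec 1 l) w • stdVec 1 l)
    rw [Fin.sum_univ_two, Fin.sum_univ_two, map_add, map_smul, map_smul, toPoly_stdVec_one_zero,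
      toPoly_stdVec_one_one]
    simp [add_comm]

theorem ketBra_su2Op (g : SU2) (w : HomPoly 1) :
    ketBra (su2Op 1 g w) =
      su2Op 1 g ∘L ketBra w ∘L ContinuousLinearMap.adjoint (su2Op 1 g) := by
  ext1 x
  simp only [ketBra, ContinuousLinearMap.comp_apply, InnerProductSpace.rankOne_apply, map_smul,
    ContinuousLinearMap.adjoint_inner_right]

theorem exists_su2Op_apply_eq_of_norm (w w' : HomPoly 1) (hw : ‖w‖ = 1) (hw' : ‖w'‖ = 1) :
    ∃ g : SU2, su2Op 1 g w = w' := by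
  obtain ⟨g, rfl⟩ := exists_su2Op_apply_eq w hw
  obtain ⟨g', rfl⟩ := exists_su2Op_apply_eq w' hw'
  refine ⟨g' * g⁻¹, ?_⟩
  rw [← ContinuousLinearMap.comp_apply, ← su2Op_mul, inv_mul_cancel_right]

theorem norm_stdVec (m : ℕ) (l : Fin (m + 1)) : ‖stdVec m l‖ = 1 := (orthonormal_stdVec m).1 l

theorem pureOutputEntropies_eq_singleton {m : ℕ}
    {Φ : (HomPoly 1 →L[ℂ] HomPoly 1) →ₗ[ℂ] (HomPoly m →L[ℂ] HomPoly m)} (hΦ : IsEquivariant Φ)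
    {c : Fin (m + 1) → ℝ} (hc : ∀ l, Φ (matUnit 0 0) (stdVec m l) = (c l : ℂ) • stdVec m l) :
    pureOutputEntropies Φ = {-∑ l, c l * Real.logb 2 (c l)} := by
  have key (w : HomPoly 1) (hw : ‖w‖ = 1) :
      vonNeumannEntropy (Φ (ketBra w)) = -∑ l, c l * Real.logb 2 (c l) := by
    obtain ⟨g, rfl⟩ := exists_su2Op_apply_eq w hw
    rw [ketBra_su2Op, hΦ]
    let e := Unitary.linearIsometryEquiv ⟨su2Op m g, su2Op_mem_unitary m g⟩
    -- The vectors $\rho_m(g)f_l$ form an eigenbasis of the conjugated output, with the same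
    -- eigenvalues.
    apply vonNeumannEntropy_of_eigenbasis ((stdBasis m).map e)
    intro l
    have he (x : HomPoly m) : e x = su2Op m g x := rfl
    have hadj (x : HomPoly m) : ContinuousLinearMap.adjoint (su2Op m g) (su2Op m g x) = x := by
      rw [adjoint_su2Op, ← ContinuousLinearMap.comp_apply, ← su2Op_mul, inv_mul_cancel, su2Op_one,
        ContinuousLinearMap.id_apply]
    rw [OrthonormalBasis.map_apply, stdBasis_apply, he, ContinuousLinearMap.comp_apply,
      ContinuousLinearMap.comp_apply, hadj]
    change su2Op m g (Φ (matUnit 0 0) (stdVec m l)) = _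
    rw [hc, map_smul]
  rw [pureOutputEntropies]
  ext s
  rw [Set.mem_singleton_iff]
  constructor
  · rintro ⟨_, ⟨w, hw, rfl⟩, rfl⟩
    exact key w hw
  · rintro rfl
    exact ⟨_, ⟨stdVec 1 0, norm_stdVec 1 0, rfl⟩, key _ (norm_stdVec 1 0)⟩

/-! ### Covariant channels on `End(P_1)` -/

theorem isEquivariant_traceOp (m : ℕ) : IsEquivariant (traceOp m) := by
  intro g A
  have h1 : LinearMap.trace ℂ (HomPoly 1) ((su2Op 1 g ∘L A ∘L
      ContinuousLinearMap.adjoint (su2Op 1 g) : HomPoly 1 →L[ℂ] HomPoly 1) :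
        HomPoly 1 →ₗ[ℂ] HomPoly 1) =
      LinearMap.trace ℂ (HomPoly 1) (A : HomPoly 1 →ₗ[ℂ] HomPoly 1) := by
    rw [adjoint_su2Op, ContinuousLinearMap.toLinearMap_comp, LinearMap.trace_comp_comm',
      ← ContinuousLinearMap.toLinearMap_comp, ContinuousLinearMap.comp_assoc, ← su2Op_mul,
      inv_mul_cancel, su2Op_one, ContinuousLinearMap.comp_id]
  change LinearMap.trace ℂ (HomPoly 1) ((su2Op 1 g ∘L A ∘L
      ContinuousLinearMap.adjoint (su2Op 1 g) : HomPoly 1 →L[ℂ] HomPoly 1) :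
        HomPoly 1 →ₗ[ℂ] HomPoly 1) • (1 : HomPoly m →L[ℂ] HomPoly m) =
      su2Op m g ∘L (LinearMap.trace ℂ (HomPoly 1) (A : HomPoly 1 →ₗ[ℂ] HomPoly 1) •
        (1 : HomPoly m →L[ℂ] HomPoly m)) ∘L ContinuousLinearMap.adjoint (su2Op m g)
  rw [h1, adjoint_su2Op, ContinuousLinearMap.smul_comp, ContinuousLinearMap.comp_smul]
  congr 1
  change _ = su2Op m g ∘L (ContinuousLinearMap.id ℂ (HomPoly m)) ∘L su2Op m g⁻¹
  rw [ContinuousLinearMap.id_comp, ← su2Op_mul, mul_inv_cancel, su2Op_one]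
  rfl

theorem eposicChannel_lower' {m : ℕ} (hm : 1 ≤ m) :
    eposicChannel m (m - 1) (m - 1) 1 = ((2 / ((m : ℝ) * (m + 1)) : ℝ) : ℂ) • lieOp m := by
  obtain ⟨h, rfl⟩ : ∃ h, m = h + 1 := ⟨m - 1, by omega⟩
  rw [Nat.add_sub_cancel, eposicChannel_lower]
  congr 3
  push_cast
  ring

/-- Complete positivity is read off the Kraus form; covariance and trace are left to the closed
forms in `lieOp` and `traceOp`. -/
theorem isCovariantChannel_eposicChannel {m n h : ℕ} (hm : 1 ≤ m)
    (hE : IsEquivariant (eposicChannel m n h 1))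
    (htr : ∀ A, LinearMap.trace ℂ (HomPoly m)
      ((eposicChannel m n h 1 A : HomPoly m →L[ℂ] HomPoly m) : HomPoly m →ₗ[ℂ] HomPoly m) =
        LinearMap.trace ℂ (HomPoly 1) (A : HomPoly 1 →ₗ[ℂ] HomPoly 1)) :
    IsCovariantChannel (eposicChannel m n h 1) := by
  obtain ⟨V, hV⟩ := exists_isometry_of_one_le hm
  exact ⟨⟨exists_completelyPositiveMap_of_kraus V hV (Finset.range (n + 1))
    (eposicKraus m n h 1) _ fun _ => rfl, htr⟩, hE⟩

theorem isCovariantChannel_upper {m : ℕ} (hm : 1 ≤ m) :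
    IsCovariantChannel (eposicChannel m (m + 1) m 1) := by
  apply isCovariantChannel_eposicChannel hm
  · rw [eposicChannel_upper, sub_eq_add_neg, ← neg_one_smul ℂ]
    exact (((isEquivariant_traceOp m).smul _).add ((isEquivariant_lieOp m).smul _)).smul _
  · intro A
    rw [eposicChannel_upper]
    change LinearMap.trace ℂ (HomPoly m)
      (((2 / (((m : ℝ) + 1) * (m + 2)) : ℝ) : ℂ) • (((m : ℂ) + 1) •
        (traceOp m A : HomPoly m →ₗ[ℂ] HomPoly m) - (lieOp m A : HomPoly m →ₗ[ℂ] HomPoly m))) = _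
    rw [map_smul, map_sub, map_smul, trace_traceOp, trace_lieOp]
    have h1 : (m : ℂ) + 1 ≠ 0 := by exact_mod_cast (by omega : m + 1 ≠ 0)
    have h2 : (m : ℂ) + 2 ≠ 0 := by exact_mod_cast (by omega : m + 2 ≠ 0)
    simp only [smul_eq_mul]
    push_cast
    field_simp
    ring

theorem isCovariantChannel_lower {m : ℕ} (hm : 1 ≤ m) :
    IsCovariantChannel (eposicChannel m (m - 1) (m - 1) 1) := by
  apply isCovariantChannel_eposicChannel hm
  · rw [eposicChannel_lower' hm]
    exact (isEquivariant_lieOp m).smul _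
  · intro A
    rw [eposicChannel_lower' hm]
    change LinearMap.trace ℂ (HomPoly m)
      (((2 / ((m : ℝ) * (m + 1)) : ℝ) : ℂ) • (lieOp m A : HomPoly m →ₗ[ℂ] HomPoly m)) = _
    rw [map_smul, trace_lieOp]
    have h1 : (m : ℂ) + 1 ≠ 0 := by exact_mod_cast (by omega : m + 1 ≠ 0)
    have h2 : (m : ℂ) ≠ 0 := by exact_mod_cast (by omega : m ≠ 0)
    simp only [smul_eq_mul]
    push_cast
    field_simp

theorem eposicChannel_mix_matUnit {m : ℕ} (hm : 1 ≤ m) (p : ℝ) (l : Fin (m + 1)) :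
    ((p : ℂ) • eposicChannel m (m + 1) m 1 +
      ((1 - p : ℝ) : ℂ) • eposicChannel m (m - 1) (m - 1) 1) (matUnit 0 0) (stdVec m l) =
      (outputEigenvalue m p (m - l) : ℂ) • stdVec m l := by
  have hl : (l : ℕ) ≤ m := by omega
  have hup : eposicChannel m (m + 1) m 1 (matUnit 0 0) (stdVec m l) =
      ((2 / (((m : ℝ) + 1) * (m + 2)) * (l + 1) : ℝ) : ℂ) • stdVec m l := by
    rw [eposicChannel_upper]
    change ((2 / (((m : ℝ) + 1) * (m + 2)) : ℝ) : ℂ) •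
      (((m : ℂ) + 1) • (traceOp m (matUnit 0 0) (stdVec m l)) -
        lieOp m (matUnit 0 0) (stdVec m l)) = _
    rw [traceOp_matUnit, if_pos rfl, one_apply_eq_self, lieOp_zero_zero, ← sub_smul, smul_smul]
    congr 1
    push_cast
    ring
  have hlo : eposicChannel m (m - 1) (m - 1) 1 (matUnit 0 0) (stdVec m l) =
      ((2 / ((m : ℝ) * (m + 1)) * (m - l) : ℝ) : ℂ) • stdVec m l := by
    rw [eposicChannel_lower' hm]
    change ((2 / ((m : ℝ) * (m + 1)) : ℝ) : ℂ) • lieOp m (matUnit 0 0) (stdVec m l) = _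
    rw [lieOp_zero_zero, smul_smul]
    congr 1
    push_cast
    ring
  change (p : ℂ) • eposicChannel m (m + 1) m 1 (matUnit 0 0) (stdVec m l) +
    ((1 - p : ℝ) : ℂ) • eposicChannel m (m - 1) (m - 1) 1 (matUnit 0 0) (stdVec m l) = _
  rw [hup, hlo, smul_smul, smul_smul, ← add_smul, ← Complex.ofReal_mul, ← Complex.ofReal_mul,
    ← Complex.ofReal_add]
  congr 2
  rw [outputEigenvalue, Nat.cast_sub hl]
  ring

theorem pureOutputEntropies_mix {m : ℕ} (hm : 1 ≤ m) (p : ℝ)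
    {Φ : (HomPoly 1 →L[ℂ] HomPoly 1) →ₗ[ℂ] (HomPoly m →L[ℂ] HomPoly m)}
    (hΦ : Φ = (p : ℂ) • eposicChannel m (m + 1) m 1 +
      ((1 - p : ℝ) : ℂ) • eposicChannel m (m - 1) (m - 1) 1) :
    pureOutputEntropies Φ = {-∑ j ∈ Finset.range (m + 1),
      outputEigenvalue m p j * Real.logb 2 (outputEigenvalue m p j)} := by
  have hE : IsEquivariant Φ := by
    rw [hΦ]
    exact (IsEquivariant.smul (isCovariantChannel_upper hm).2 _).add
      (IsEquivariant.smul (isCovariantChannel_lower hm).2 _)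
  rw [pureOutputEntropies_eq_singleton hE
    (c := fun l => outputEigenvalue m p (m - l)) (by
      intro l
      rw [hΦ]
      exact eposicChannel_mix_matUnit hm p l)]
  -- The eigenvalue at $f_l$ is $\lambda_{m-l}$, so the sum is reversed.
  rw [Fin.sum_univ_eq_sum_range
    (fun l => outputEigenvalue m p (m - l) * Real.logb 2 (outputEigenvalue m p (m - l))),
    ← Finset.sum_range_reflect
    (fun l => outputEigenvalue m p l * Real.logb 2 (outputEigenvalue m p l))]
  simp only [Nat.add_sub_cancel]

theorem smul_add_smul_eq {M : Type*} [AddCommGroup M] [Module ℂ M] (L T : M)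
    {a b p q u v k : ℂ} (ha : a = q * v - p * u) (hb : b = p * u * k) :
    a • L + b • T = p • u • (k • T - L) + q • v • L := by
  rw [ha, hb]
  module

/-- The trace condition eliminates $\alpha$; testing the Choi form on one eigenvector for each of
its two eigenvalues gives $p\ge0$ and $p\le1$. -/
theorem IsCovariantChannel.exists_eq_mix {m : ℕ} (hm : 1 ≤ m)
    {Φ : (HomPoly 1 →L[ℂ] HomPoly 1) →ₗ[ℂ] (HomPoly m →L[ℂ] HomPoly m)}
    (hΦ : IsCovariantChannel Φ) :
    ∃ p : ℝ, 0 ≤ p ∧ p ≤ 1 ∧ Φ = (p : ℂ) • eposicChannel m (m + 1) m 1 +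
      ((1 - p : ℝ) : ℂ) • eposicChannel m (m - 1) (m - 1) 1 := by
  obtain ⟨α, β, hαβ⟩ := IsEquivariant.exists_eq hm hΦ.2
  obtain ⟨φ, hφ⟩ := hΦ.1.1
  have hdiag (a : Fin 2) (x : HomPoly m) :
      Φ (matUnit a a) x = α • lieOp m (matUnit a a) x + β • x := by
    rw [hαβ]
    change α • lieOp m (matUnit a a) x + β • traceOp m (matUnit a a) x = _
    rw [traceOp_matUnit, if_pos rfl, one_apply_eq_self]
  have hoff (a b : Fin 2) (hab : a ≠ b) (x : HomPoly m) :
      Φ (matUnit a b) x = α • lieOp m (matUnit a b) x := by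
    rw [hαβ]
    change α • lieOp m (matUnit a b) x + β • traceOp m (matUnit a b) x = _
    rw [traceOp_matUnit, if_neg hab, zero_apply, smul_zero, add_zero]
  have htr : α * ((m : ℂ) * (m + 1) / 2) + β * ((m : ℂ) + 1) = 1 := by
    have h1 := hΦ.1.2 (matUnit 0 0)
    rw [hαβ] at h1
    change LinearMap.trace ℂ (HomPoly m) (α • (lieOp m (matUnit 0 0) : HomPoly m →ₗ[ℂ] HomPoly m) +
      β • (traceOp m (matUnit 0 0) : HomPoly m →ₗ[ℂ] HomPoly m)) = _ at h1
    rw [map_add, map_smul, map_smul, trace_lieOp, trace_traceOp, trace_matUnit, if_pos rfl] at h1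
    simpa using h1
  have hpos (v : Fin 2 → HomPoly m) : ∃ x : ℝ, 0 ≤ x ∧
      ∑ a : Fin 2, ∑ b : Fin 2, inner ℂ (v a) (Φ (matUnit a b) (v b)) = x := by
    obtain ⟨x, hx, h⟩ := CompletelyPositiveMap.sum_inner_nonneg φ (k := 1) (stdVec 1)
      (norm_stdVec 1 0) v
    rw [hφ] at h
    exact ⟨x, hx, h⟩
  -- On $(f_m,0)$ the `lieOp` part vanishes, which isolates the Choi eigenvalue $\beta$.
  obtain ⟨x, hx, hβ⟩ := hpos ![stdVec m (Fin.last m), 0]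
  have hβx : β = x := by
    rw [← hβ]
    simp only [Fin.sum_univ_two, Matrix.cons_val_zero, Matrix.cons_val_one, map_zero,
      inner_zero_left, inner_zero_right, add_zero, hdiag, if_true, lieOp_zero_zero, Fin.val_last,
      sub_self, zero_smul, smul_zero, zero_add, inner_smul_right, inner_stdVec_stdVec, mul_one]
  obtain ⟨n, rfl⟩ : ∃ n, m = n + 1 := ⟨m - 1, by omega⟩
  -- With $m=n+1$, the vector $(\sqrt m\,f_0,f_1)$ is a Choi eigenvector for $\alpha(m+1)+\beta$;
  -- its squared norm is $m+1=n+2$.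
  obtain ⟨y, hy, hαy⟩ := hpos ![(√((n : ℝ) + 1) : ℂ) • stdVec (n + 1) 0, stdVec (n + 1) 1]
  have hs : (√((n : ℝ) + 1) : ℂ) * (√((n : ℝ) + 1) : ℂ) = (n : ℂ) + 1 := by
    rw [← Complex.ofReal_mul, Real.mul_self_sqrt (by positivity)]
    push_cast
    rfl
  have h01 : lieOp (n + 1) (matUnit 0 1) (stdVec (n + 1) 1) =
      (√((n : ℝ) + 1) : ℂ) • stdVec (n + 1) 0 := by
    have := lieOp_zero_one_succ (n + 1) 0 (by omega)
    simpa using this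
  have h10 : lieOp (n + 1) (matUnit 1 0) (stdVec (n + 1) 0) =
      (√((n : ℝ) + 1) : ℂ) • stdVec (n + 1) 1 := by
    have := lieOp_one_zero_of_lt (n + 1) 0 (by omega)
    simpa using this
  have hyeq : ((n : ℂ) + 2) * (α * (n + 2) + β) = y := by
    rw [← hαy]
    simp only [Fin.sum_univ_two, Matrix.cons_val_zero, Matrix.cons_val_one, hdiag,
      hoff 0 1 (by decide), hoff 1 0 (by decide), map_smul, h01, h10, lieOp_zero_zero,
      lieOp_one_one, if_true, inner_add_right, inner_smul_right, inner_smul_left,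
      inner_stdVec_stdVec, Complex.conj_ofReal]
    simp only [Fin.val_zero, Fin.val_one]
    push_cast
    linear_combination (-(α * (n + 1) + β) - 2 * α) * hs
  subst hβx
  have hn : (0 : ℝ) < (n : ℝ) + 1 := by positivity
  have hnC : (n : ℂ) + 1 ≠ 0 := by exact_mod_cast hn.ne'
  have hnC2 : (n : ℂ) + 2 ≠ 0 := by exact_mod_cast (by positivity : (0 : ℝ) < (n : ℝ) + 2).ne'
  have hnC3 : (n : ℂ) + 3 ≠ 0 := by exact_mod_cast (by positivity : (0 : ℝ) < (n : ℝ) + 3).ne'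
  have hnC4 : (n : ℂ) + 1 + 1 ≠ 0 := by rwa [add_assoc, one_add_one_eq_two]
  have hnC5 : (n : ℂ) + 1 + 2 ≠ 0 := by
    rwa [add_assoc, show (1 : ℂ) + 2 = 3 by norm_num]
  push_cast at htr
  have hα : α = (1 - x * ((n : ℂ) + 2)) * (2 / (((n : ℂ) + 1) * (n + 2))) := by
    field_simp
    linear_combination 2 * htr
  -- $p=\beta(m+2)/2$, the share of the Choi trace $2$ carried by the eigenvalue $\beta$. The bound
  -- $p\le1$ follows from $\alpha(m+1)+\beta=2(1-p)/m$.
  refine ⟨x * (n + 3) / 2, by positivity, ?_, ?_⟩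
  · rw [hα] at hyeq
    have h2 : (n + 2) * ((1 - x * (n + 2)) * (2 / (((n : ℝ) + 1) * (n + 2))) * (n + 2) + x) = y := by
      apply Complex.ofReal_injective
      push_cast
      exact hyeq
    have h3 : (n + 2) * ((1 - x * (n + 2)) * (2 / (((n : ℝ) + 1) * (n + 2))) * (n + 2) + x) =
        (1 - x * (n + 3) / 2) * (2 * (n + 2) / (n + 1)) := by
      field_simp
      ring
    rw [h3] at h2
    have h4 : 0 ≤ (1 - x * (n + 3) / 2) * (2 * (n + 2) / (n + 1)) := h2 ▸ hy
    have h5 := nonneg_of_mul_nonneg_left h4 (by positivity)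
    linarith
  · rw [hαβ, eposicChannel_upper, eposicChannel_lower' hm, hα]
    refine smul_add_smul_eq _ _ ?_ ?_
    · push_cast
      field_simp
      ring
    · push_cast
      field_simp
      ring

theorem pureOutputEntropies_upper {m : ℕ} (hm : 1 ≤ m) :
    pureOutputEntropies (eposicChannel m (m + 1) m 1) = {-∑ j ∈ Finset.range (m + 1),
      outputEigenvalue m 1 j * Real.logb 2 (outputEigenvalue m 1 j)} :=
  pureOutputEntropies_mix hm 1 (by simp)

theorem pureOutputEntropies_lower {m : ℕ} (hm : 1 ≤ m) :
    pureOutputEntropies (eposicChannel m (m - 1) (m - 1) 1) = {-∑ j ∈ Finset.range (m + 1),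
      outputEigenvalue m 0 j * Real.logb 2 (outputEigenvalue m 0 j)} :=
  pureOutputEntropies_mix hm 0 (by simp)

end

/-! ### Assembling the proposition -/

theorem minOutputEntropy_of_eq_singleton {r m : ℕ}
    {Φ : (HomPoly r →L[ℂ] HomPoly r) →ₗ[ℂ] (HomPoly m →L[ℂ] HomPoly m)} {s : ℝ}
    (h : pureOutputEntropies Φ = {s}) : minOutputEntropy Φ = s := by
  rw [minOutputEntropy, h, csInf_singleton]

theorem Finset.sum_Icc_one_eq_sum_range {M : Type*} [AddCommMonoid M] (f : ℕ → M) (n : ℕ) :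
    ∑ j ∈ Finset.Icc 1 n, f j = ∑ j ∈ Finset.range n, f (j + 1) := by
  induction n with
  | zero => simp
  | succ n ih => rw [Finset.sum_Icc_succ_top (by omega), Finset.sum_range_succ, ih]

theorem proposition3p8 (m : ℕ) (hm : 1 ≤ m) :
    (∀ Φ : (HomPoly 1 →L[ℂ] HomPoly 1) →ₗ[ℂ] (HomPoly m →L[ℂ] HomPoly m),
      IsCovariantChannel Φ →
        (∃ p : ℝ, 0 ≤ p ∧ p ≤ 1 ∧
          Φ = (p : ℂ) • eposicChannel m (m + 1) m 1 +
            ((1 - p : ℝ) : ℂ) • eposicChannel m (m - 1) (m - 1) 1 ∧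
          minOutputEntropy Φ =
            -∑ j ∈ Finset.range (m + 1),
              outputEigenvalue m p j * Real.logb 2 (outputEigenvalue m p j)) ∧
        IsLeast (pureOutputEntropies Φ) (minOutputEntropy Φ) ∧
        (∀ w w' : HomPoly 1, ‖w‖ = 1 → ‖w'‖ = 1 →
          ∃ U ∈ unitary (HomPoly m →L[ℂ] HomPoly m),
            Φ (ketBra w') = U * Φ (ketBra w) * star U)) ∧
    (IsCovariantChannel (eposicChannel m (m + 1) m 1) ∧
      minOutputEntropy (eposicChannel m (m + 1) m 1) =
        -∑ j ∈ Finset.Icc 1 (m + 1),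
          (2 * (j : ℝ) / (((m : ℝ) + 1) * (m + 2))) *
            Real.logb 2 (2 * (j : ℝ) / (((m : ℝ) + 1) * (m + 2)))) ∧
    (IsCovariantChannel (eposicChannel m (m - 1) (m - 1) 1) ∧
      minOutputEntropy (eposicChannel m (m - 1) (m - 1) 1) =
        -∑ j ∈ Finset.Icc 1 m,
          (2 * (j : ℝ) / ((m : ℝ) * (m + 1))) *
            Real.logb 2 (2 * (j : ℝ) / ((m : ℝ) * (m + 1)))) := by
  refine ⟨fun Φ hΦ => ?_, ⟨isCovariantChannel_upper hm, ?_⟩, isCovariantChannel_lower hm, ?_⟩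
  · obtain ⟨p, h0, h1, hp⟩ := hΦ.exists_eq_mix hm
    have hs := pureOutputEntropies_mix hm p hp
    refine ⟨⟨p, h0, h1, hp, minOutputEntropy_of_eq_singleton hs⟩, ?_, fun w w' hw hw' => ?_⟩
    · rw [minOutputEntropy_of_eq_singleton hs, hs]
      exact isLeast_singleton
    · obtain ⟨g, rfl⟩ := exists_su2Op_apply_eq_of_norm w w' hw hw'
      refine ⟨su2Op m g, su2Op_mem_unitary m g, ?_⟩
      rw [ketBra_su2Op, hΦ.2]
      rfl
  -- At $p=1$ the eigenvalues $\lambda_0,\dots,\lambda_m$ decrease, so the sum is reflected to match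
  -- the increasing index.
  · rw [minOutputEntropy_of_eq_singleton (pureOutputEntropies_upper hm), neg_inj,
      Finset.sum_Icc_one_eq_sum_range, ← Finset.sum_range_reflect]
    refine Finset.sum_congr rfl fun j hj => ?_
    have hj' : j ≤ m := by simpa [Nat.lt_succ_iff] using hj
    have h : outputEigenvalue m 1 (m + 1 - 1 - j) =
        2 * ((j + 1 : ℕ) : ℝ) / (((m : ℝ) + 1) * (m + 2)) := by
      rw [outputEigenvalue, Nat.add_sub_cancel, Nat.cast_sub hj']
      push_cast
      ring
    rw [h]
  -- At $p=0$ the term $\lambda_0=0$ is split off; it contributes $0\log_20=0$.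
  · rw [minOutputEntropy_of_eq_singleton (pureOutputEntropies_lower hm), neg_inj,
      Finset.sum_Icc_one_eq_sum_range, Finset.sum_range_succ']
    simp [outputEigenvalue]
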